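/- **Setting.** Let $\Omega\subset\mathbb R^d$ be open and bounded, $\Gamma_D\subset\partial\Omega$ measurable with $|\Gamma_D|>0$, $\Gamma_N=\partial\Omega\setminus\Gamma_D$, $f\in L^2(\Omega)$, $g\in L^2(\Gamma_N)$, and let $\mathbb A=\mathbb A^\varepsilon$ be a measurable field of symmetric matrices with $\alpha|\xi|^2\le \mathbb A(x)\xi\cdot\xi\le\beta|\xi|^2$ for all $\xi$ and a.e. $x\in\Omega$ ($\alpha,\beta>0$). Put $V=\{v\in H^1(\Omega):v=0\text{ on }\Gamma_D\}$ (in the sense of traces), $B(u,v)=\int_\Omega\mathbb A\nabla u\cdot\nabla v$, $B^*(u,v)=B(v,u)$, $F(v)=\int_\Omega fv+\int_{\Gamma_N}gv$, and let $u^\varepsilon\in V$ satisfy $B(u^\varepsilon,v)=F(v)$ for all $v\in V$. Let $\mathcal T_H$ be a conforming partition of $\Omega$ (so $\Omega$ is the interior of the union of the closed elements) into finitely many simplices and parallelotopes, with first-order Lagrange basis functions $\phi^0_i$ attached to its vertices. Let $V_H^\varepsilon$ (trial) and $W_H$ (test; $W_H=V_H^\varepsilon$ for Galerkin variants) be finite-dimensional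 spaces of functions that are $H^1$ in each element, let $B_H$ be the broken form $\sum_K\int_K\mathbb A\nabla u\cdot\nabla v$ and $B_H^*(u,v)=B_H(v,u)$. Let $u_H^\varepsilon\in V^\varepsilon_H$ satisfy $B_H(u^\varepsilon_H,v)=F(v)$ for all $v\in W_H$ (with traces taken element by element in $F$), and let $\widehat u_H\in V$ be arbitrary (one takes $\widehat u_H=u_H^\varepsilon$ if $V_H^\varepsilon\subset V$). Let $Q(v)=\int_\Omega(f_Qv+q_Q\cdot\nabla v)$ with $f_Q\in L^2(\Omega)$, $q_Q\in L^2(\Omega)^d$, extended to piecewise $H^1$ functions through the elementwise gradient, and $\Delta Q=Q(\widehat u_H-u^\varepsilon_H)$. Let $\mathcal S$ be the set of $p\in H(\mathrm{div},\Omega)$ with $\int_\Omega p\cdot\nabla v=F(v)$ for all $v\in V$, and $\widetilde{\mathcal S}$ the set of $p\in H(\mathrm{div},\Omega)$ with $\int_\Omega p\cdot\nabla v=Q(v)$ for all $v\in V$. Put $$E_{CRE}(v,p)=\Big(\int_\Omega\mathbb A^{-1}(p-\mathbb A\nabla v)\cdot(p-\mathbb A\nabla v)\Big)^{1/2},$$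 and let $\widehat q_H\in\mathcal S$ be arbitrary. **Enrichment.** Let $\Omega_{hand}\subset\Omega$ be open, and let $\widetilde u_{hand}\in H^1_0(\Omega_{hand})$, extended by zero, satisfy $B^*(\widetilde u_{hand},v)=Q(v)$ for all $v\in H^1_0(\Omega_{hand})$. Let $\Omega_1\subset\Omega_{hand}$ be the interior of a union of closed elements of $\mathcal T_H$, such that $f_Q$ and $q_Q$ vanish a.e. in $\Omega\setminus\Omega_1$. Let $I^{PUM}$ be the set of vertices of $\mathcal T_H$ in $\overline{\Omega_1}$ and $\Sigma=\sum_{i\in I^{PUM}}\phi^0_i$; assume that $\Omega_1=\{x\in\Omega:\Sigma(x)=1\}$ up to a null set, and let $\Omega_2=\{x\in\Omega:\Sigma(x)\in(0,1)\}$. Put $w=\widetilde u_{hand}\,\Sigma$. The adjoint solution is approximated by $\widetilde u_+=w+\widetilde u_{res,H}$, where $\widetilde u_{res,H}\in V_H^\varepsilon$ satisfies $B_H^*(\widetilde u_{res,H},v)=Q(v)-B_H^*(w,v)$ for all $v\in W_H$. Let $\widehat{\widetilde u}_{res,H}\in V$ be arbitrary (equal to $\widetilde u_{res,H}$ in the conforming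 case). For $v\in V$ set $$L_{res}(v)=-\int_{\partial\Omega_1}\big((\mathbb A\nabla\widetilde u_{hand}-q_Q)\cdot n\big)v-\int_{\Omega_2}\mathbb A\nabla w\cdot\nabla v,$$ where $n$ is the outward normal to $\Omega_1$ and the boundary term is the $H(\mathrm{div},\Omega_1)$ normal-trace pairing. Let $\widehat{\widetilde q}_{res,H}\in L^2(\Omega)^d$ satisfy $\int_\Omega\widehat{\widetilde q}_{res,H}\cdot\nabla v=L_{res}(v)$ for all $v\in V$. Define $$\widehat{\widetilde u}_+=w+\widehat{\widetilde u}_{res,H},\qquad \widehat{\widetilde q}_+=\mathbb A\nabla w+\widehat{\widetilde q}_{res,H},\qquad \overline C_{H+}=\frac12\int_\Omega\mathbb A^{-1}(\widehat q_H-\mathbb A\nabla\widehat u_H)\cdot(\widehat{\widetilde q}_++\mathbb A\nabla\widehat{\widetilde u}_+).$$ **Claim.** 1. The elementwise extension of $Q$ agrees with $Q$ on $H^1(\Omega)$; $w\in V$ and $\widehat{\widetilde u}_+\in V$. 2. $\mathbb A\nabla\widetilde u_{hand}-q_Q\in H(\mathrm{div},\Omega_1)$, and for all $v\in V$, $Q(v)-B^*(w,v)=Q(v)-\int_{\Omega_1}\mathbb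 A\nabla\widetilde u_{hand}\cdot\nabla v-\int_{\Omega_2}\mathbb A\nabla w\cdot\nabla v=L_{res}(v)$. 3. $\widehat{\widetilde q}_+\in L^2(\Omega)^d$ and $\int_\Omega\widehat{\widetilde q}_+\cdot\nabla v=Q(v)$ for all $v\in V$; if $q_Q\in H(\mathrm{div},\Omega)$, in particular if $q_Q=0$, then $\widehat{\widetilde q}_+\in\widetilde{\mathcal S}$. 4. $\displaystyle\big|Q(u^\varepsilon)-Q(u^\varepsilon_H)-\Delta Q-\overline C_{H+}\big|\le\tfrac12E_{CRE}(\widehat u_H,\widehat q_H)\,E_{CRE}(\widehat{\widetilde u}_+,\widehat{\widetilde q}_+)$ and $E_{CRE}(\widehat{\widetilde u}_+,\widehat{\widetilde q}_+)=E_{CRE}(\widehat{\widetilde u}_{res,H},\widehat{\widetilde q}_{res,H})$. 5. $\displaystyle|Q(u^\varepsilon)-Q(u^\varepsilon_H)|\le\eta^Q:=\max_{\theta=\pm1}\Big|\Delta Q+\overline C_{H+}+\frac\theta2E_{CRE}(\widehat u_H,\widehat q_H)\,E_{CRE}(\widehat{\widetilde u}_{res,H},\widehat{\widetilde q}_{res,H})\Big|.$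 -/

import Mathlib

open MeasureTheory Filter Topology Set
open scoped ENNReal ContDiff

noncomputable section

namespace MsFEM

/-- The Euclidean space `ℝ^d`. -/
abbrev Euc (d : ℕ) := EuclideanSpace ℝ (Fin d)

variable {d : ℕ}

/-! ### Sobolev spaces, `H(div)`, traces -/

/-- `φ ∈ C_c^∞(U)`. -/
def IsTest (U : Set (Euc d)) (φ : Euc d → ℝ) : Prop :=
  ContDiff ℝ ∞ φ ∧ HasCompactSupport φ ∧ tsupport φ ⊆ U

/-- `G` is the weak gradient of `u` in the open set `U`. -/
def HasWeakGrad (U : Set (Euc d)) (u : Euc d → ℝ) (G : Euc d → Euc d) : Prop :=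
  ∀ φ : Euc d → ℝ, IsTest U φ → ∀ e : Euc d,
    ∫ x in U, u x * fderiv ℝ φ x e = - ∫ x in U, φ x * inner ℝ (G x) e

/-- `u ∈ H^1(U)`. -/
def MemH1 (U : Set (Euc d)) (u : Euc d → ℝ) : Prop :=
  MemLp u 2 (volume.restrict U) ∧
    ∃ G : Euc d → Euc d, MemLp G 2 (volume.restrict U) ∧ HasWeakGrad U u G

open Classical in
/-- The weak gradient `∇u` of `u ∈ H^1(U)` (unique up to null sets; `0` if `u ∉ H^1(U)`). -/
def wgrad (U : Set (Euc d)) (u : Euc d → ℝ) : Euc d → Euc d :=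
  if h : MemH1 U u then h.2.choose else 0

/-- `D` is the weak divergence of the field `p` in the open set `U`. -/
def HasWeakDiv (U : Set (Euc d)) (p : Euc d → Euc d) (D : Euc d → ℝ) : Prop :=
  ∀ φ : Euc d → ℝ, IsTest U φ →
    ∫ x in U, fderiv ℝ φ x (p x) = - ∫ x in U, D x * φ x

/-- `p ∈ H(div, U)`. -/
def MemHdiv (U : Set (Euc d)) (p : Euc d → Euc d) : Prop :=
  MemLp p 2 (volume.restrict U) ∧
    ∃ D : Euc d → ℝ, MemLp D 2 (volume.restrict U) ∧ HasWeakDiv U p D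

open Classical in
/-- The weak divergence of `p ∈ H(div, U)` (unique up to null sets; `0` if `p ∉ H(div, U)`). -/
def wdiv (U : Set (Euc d)) (p : Euc d → Euc d) : Euc d → ℝ :=
  if h : MemHdiv U p then h.2.choose else 0

/-- The normal-trace pairing `∫_{∂U} (p · n) v` of `p ∈ H(div, U)` with `v ∈ H^1(U)`, where `n` is
the outward unit normal: as usual for fields in `H(div, U)`, whose normal trace lies in
`H^{-1/2}(∂U)`, it is defined by Green's formula. -/
def normalPairing (U : Set (Euc d)) (p : Euc d → Euc d) (v : Euc d → ℝ) : ℝ :=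
  (∫ x in U, inner ℝ (p x) (wgrad U v x)) + ∫ x in U, wdiv U p x * v x

/-- Convergence `w n → u` in the norm of `H^1(U)`. -/
def TendstoH1 (U : Set (Euc d)) (w : ℕ → Euc d → ℝ) (u : Euc d → ℝ) : Prop :=
  Tendsto (fun n => eLpNorm (w n - u) 2 (volume.restrict U)) atTop (𝓝 0) ∧
  Tendsto (fun n => eLpNorm (wgrad U (w n) - wgrad U u) 2 (volume.restrict U)) atTop (𝓝 0)

/-- `u ∈ H^1_0(U)`, the closure of `C_c^∞(U)` in `H^1(U)`. Its elements are extended by zero to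
the whole space. -/
def MemH10 (U : Set (Euc d)) (u : Euc d → ℝ) : Prop :=
  (∀ x, x ∉ U → u x = 0) ∧ MemH1 U u ∧
    ∃ ψ : ℕ → Euc d → ℝ, (∀ n, IsTest U (ψ n)) ∧ TendstoH1 U ψ u

/-- The surface measure (`(d-1)`-dimensional Hausdorff measure, normalised so as to coincide with
the Lebesgue measure on hyperplanes). -/
def surf (d : ℕ) : Measure (Euc d) := Measure.euclideanHausdorffMeasure (d - 1)

/-- `t ∈ L^2(∂U)` is the trace of `u ∈ H^1(U)`: the extension by continuity of the restriction to
`∂U` of the functions in `H^1(U) ∩ C(closure U)`. -/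
def HasTrace (U : Set (Euc d)) (u t : Euc d → ℝ) : Prop :=
  MemH1 U u ∧ MemLp t 2 ((surf d).restrict (frontier U)) ∧
    ∃ w : ℕ → Euc d → ℝ, (∀ n, ContinuousOn (w n) (closure U) ∧ MemH1 U (w n)) ∧
      TendstoH1 U w u ∧
      Tendsto (fun n => eLpNorm (w n - t) 2 ((surf d).restrict (frontier U))) atTop (𝓝 0)

/-! ### The model problem -/

/-- The product `M ξ` of a matrix and a vector. -/
def act (M : Matrix (Fin d) (Fin d) ℝ) (ξ : Euc d) : Euc d := Matrix.toEuclideanLin M ξ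

/-- Data and standing assumptions of the model problem
`-∇·(A∇u) = f` in `Ω`, `u = 0` on `Γ_D`, `A∇u·n = g` on `Γ_N = ∂Ω ∖ Γ_D`. -/
structure ModelProblem (d : ℕ) where
  Ω : Set (Euc d)
  isOpen : IsOpen Ω
  bounded : Bornology.IsBounded Ω
  ΓD : Set (Euc d)
  ΓD_subset : ΓD ⊆ frontier Ω
  ΓD_measurable : MeasurableSet ΓD
  ΓD_pos : 0 < surf d ΓD
  A : Euc d → Matrix (Fin d) (Fin d) ℝ
  A_measurable : ∀ i j, AEStronglyMeasurable (fun x => A x i j) (volume.restrict Ω)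
  A_symm : ∀ᵐ x ∂(volume.restrict Ω), (A x).IsSymm
  A_elliptic : ∃ α β : ℝ, 0 < α ∧ 0 < β ∧ ∀ᵐ x ∂(volume.restrict Ω), ∀ ξ : Euc d,
    α * ‖ξ‖ ^ 2 ≤ inner ℝ (act (A x) ξ) ξ ∧ inner ℝ (act (A x) ξ) ξ ≤ β * ‖ξ‖ ^ 2
  f : Euc d → ℝ
  f_memLp : MemLp f 2 (volume.restrict Ω)
  g : Euc d → ℝ
  g_memLp : MemLp g 2 ((surf d).restrict (frontier Ω \ ΓD))

namespace ModelProblem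

variable (P : ModelProblem d)

/-- The Neumann boundary `Γ_N`. -/
def ΓN : Set (Euc d) := frontier P.Ω \ P.ΓD

/-- `v ∈ V`, with boundary trace `t`: `v ∈ H^1(Ω)` and `v = 0` on `Γ_D`. -/
def MemVWith (v t : Euc d → ℝ) : Prop :=
  HasTrace P.Ω v t ∧ ∀ᵐ x ∂((surf d).restrict P.ΓD), t x = 0

/-- `v ∈ V = {v ∈ H^1(Ω), v = 0 on Γ_D}`. -/
def MemV (v : Euc d → ℝ) : Prop := ∃ t, P.MemVWith v t

/-- `B(u,v) = ∫_Ω A∇u·∇v`. -/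
def B (u v : Euc d → ℝ) : ℝ :=
  ∫ x in P.Ω, inner ℝ (act (P.A x) (wgrad P.Ω u x)) (wgrad P.Ω v x)

/-- The adjoint form `B^*(u,v) = B(v,u)`. -/
def Bstar (u v : Euc d → ℝ) : ℝ := P.B v u

/-- The load `∫_Ω f v + ∫_{Γ_N} g t`, where `t` is the trace of `v`. -/
def load (v t : Euc d → ℝ) : ℝ :=
  (∫ x in P.Ω, P.f x * v x) + ∫ x in P.ΓN, P.g x * t x ∂(surf d)

/-- `u ∈ V` is a weak solution: `B(u,v) = F(v)` for all `v ∈ V`. -/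
def IsSolution (u : Euc d → ℝ) : Prop :=
  P.MemV u ∧ ∀ v t, P.MemVWith v t → P.B u v = P.load v t

/-- `p ∈ S`: the equilibrated fluxes of the primal problem. -/
def MemS (p : Euc d → Euc d) : Prop :=
  MemHdiv P.Ω p ∧ ∀ v t, P.MemVWith v t →
    ∫ x in P.Ω, inner ℝ (p x) (wgrad P.Ω v x) = P.load v t

/-- The flux `A∇u`. -/
def flux (u : Euc d → ℝ) (x : Euc d) : Euc d := act (P.A x) (wgrad P.Ω u x)

/-- The constitutive relation error
`E_CRE(u,p) = (∫_Ω A⁻¹ (p - A∇u) · (p - A∇u))^{1/2}`. -/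
def ECRE (u : Euc d → ℝ) (p : Euc d → Euc d) : ℝ :=
  Real.sqrt (∫ x in P.Ω, inner ℝ (act (P.A x)⁻¹ (p x - P.flux u x)) (p x - P.flux u x))

/-- The quantity of interest `Q(v) = ∫_Ω (f_Q v + q_Q · ∇v)`, for `v ∈ V`. -/
def Q (fQ : Euc d → ℝ) (qQ : Euc d → Euc d) (v : Euc d → ℝ) : ℝ :=
  ∫ x in P.Ω, (fQ x * v x + inner ℝ (qQ x) (wgrad P.Ω v x))

/-- The fields `p ∈ L^2(Ω)^d` with `∫_Ω p·∇v = Q(v)` for all `v ∈ V`. -/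
def MemSAdjWeak (fQ : Euc d → ℝ) (qQ : Euc d → Euc d) (p : Euc d → Euc d) : Prop :=
  MemLp p 2 (volume.restrict P.Ω) ∧ ∀ v, P.MemV v →
    ∫ x in P.Ω, inner ℝ (p x) (wgrad P.Ω v x) = P.Q fQ qQ v

/-- The space of equilibrated fluxes of the adjoint problem: the fields `p ∈ H(div, Ω)` with
`∫_Ω p·∇v = Q(v)` for all `v ∈ V`. -/
def MemSAdj (fQ : Euc d → ℝ) (qQ : Euc d → Euc d) (p : Euc d → Euc d) : Prop :=
  MemHdiv P.Ω p ∧ ∀ v, P.MemV v →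
    ∫ x in P.Ω, inner ℝ (p x) (wgrad P.Ω v x) = P.Q fQ qQ v

end ModelProblem

/-! ### Coarse mesh and first-order Lagrange basis functions -/

/-- A mesh element: a simplex, given by its vertices, or a parallelotope, given by a vertex and the
edges issued from it. -/
inductive Cell (d : ℕ) where
  | simplex (b : AffineBasis (Fin (d + 1)) ℝ (Euc d))
  | box (p : Euc d) (b : Module.Basis (Fin d) ℝ (Euc d))

namespace Cell

/-- The vertex `p + ∑_{j, σ j} b_j` of a parallelotope. -/
def boxVertex (p : Euc d) (b : Module.Basis (Fin d) ℝ (Euc d)) (σ : Fin d → Bool) : Euc d :=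
  p + ∑ j, if σ j then b j else 0

/-- The closed element. -/
def closed : Cell d → Set (Euc d)
  | simplex b => convexHull ℝ (range b)
  | box p b => {x | ∀ j, b.repr (x - p) j ∈ Icc (0 : ℝ) 1}

/-- The open element. -/
def carrier (K : Cell d) : Set (Euc d) := interior K.closed

open Classical in
/-- The vertices of the element. -/
def vertices : Cell d → Finset (Euc d)
  | simplex b => Finset.univ.image b
  | box p b => Finset.univ.image (boxVertex p b)

open Classical in
/-- The local first-order Lagrange function of the point `s`: if `s` is a vertex, the barycentric
coordinate (simplex) or the multilinear function (parallelotope) with value `1` at `s` and `0` at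
the other vertices; `0` if `s` is not a vertex. -/
def shape : Cell d → Euc d → Euc d → ℝ
  | simplex b, s, x => ∑ i, if b i = s then b.coord i x else 0
  | box p b, s, x => ∑ σ : Fin d → Bool, if boxVertex p b σ = s then
      ∏ j, (if σ j then b.repr (x - p) j else 1 - b.repr (x - p) j) else 0

end Cell

/-- A conforming partition of `Ω` into finitely many elements. -/
structure Mesh (Ω : Set (Euc d)) where
  N : ℕ
  K : Fin N → Cell d
  interior_cover : interior (⋃ k, (K k).closed) = Ω
  disjoint : ∀ k l, k ≠ l → Disjoint (K k).carrier (K l).carrier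
  conforming : ∀ k l, k ≠ l →
    (K k).closed ∩ (K l).closed
      = convexHull ℝ (((K k).vertices : Set (Euc d)) ∩ ((K l).vertices : Set (Euc d))) ∧
    IsExtreme ℝ (K k).closed ((K k).closed ∩ (K l).closed)

namespace Mesh

variable {Ω : Set (Euc d)} (T : Mesh Ω)

open Classical in
/-- The vertices of the mesh. -/
def vertices : Finset (Euc d) := Finset.univ.biUnion fun k => (T.K k).vertices

/-- `φ s`, for `s` a vertex of the mesh, is the first-order Lagrange (nodal) basis function
associated with `s`; this determines `φ s` on the closure of `Ω`. -/
def IsLagrangeBasis (φ : Euc d → Euc d → ℝ) : Prop :=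
  ∀ s ∈ T.vertices, ∀ k, ∀ x ∈ (T.K k).closed, φ s x = (T.K k).shape s x

/-- The subdomain made of the union of the elements indexed by `J`. -/
def subdomain (J : Finset (Fin T.N)) : Set (Euc d) := interior (⋃ k ∈ J, (T.K k).closed)

open Classical in
/-- The set of the vertices of the mesh located in the closure of `U`. -/
def verticesIn (U : Set (Euc d)) : Finset (Euc d) := T.vertices.filter (· ∈ closure U)

/-- `∑_{i ∈ I} φ_i`, where `I` is the set of the vertices located in the closure of `U`. -/
def pum (φ : Euc d → Euc d → ℝ) (U : Set (Euc d)) (x : Euc d) : ℝ :=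
  ∑ s ∈ T.verticesIn U, φ s x

/-- Broken Sobolev space: the functions that are `H^1` in each element. -/
def MemBrokenH1 (v : Euc d → ℝ) : Prop := ∀ k, MemH1 (T.K k).carrier v

/-- `t` is the trace on `∂Ω` of the piecewise `H^1` function `v`, taken element by element. -/
def HasBrokenTrace (v t : Euc d → ℝ) : Prop :=
  ∀ k, ∃ s, HasTrace (T.K k).carrier v s ∧
    ∀ᵐ x ∂((surf d).restrict (frontier (T.K k).carrier ∩ frontier Ω)), s x = t x

end Mesh

namespace ModelProblem

variable (P : ModelProblem d) (T : Mesh P.Ω)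

/-- The broken form `B_H(u,v) = ∑_K ∫_K A∇u·∇v`. -/
def BH (u v : Euc d → ℝ) : ℝ :=
  ∑ k, ∫ x in (T.K k).carrier,
    inner ℝ (act (P.A x) (wgrad (T.K k).carrier u x)) (wgrad (T.K k).carrier v x)

/-- The quantity of interest on piecewise `H^1` functions:
`∑_K ∫_K (f_Q v + q_Q·∇v)`. -/
def QH (fQ : Euc d → ℝ) (qQ : Euc d → Euc d) (v : Euc d → ℝ) : ℝ :=
  ∑ k, ∫ x in (T.K k).carrier, (fQ x * v x + inner ℝ (qQ x) (wgrad (T.K k).carrier v x))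

/-- `uH` is the MsFEM approximation, with trial space `VH` and test space `WH`
(`WH = VH` for the Galerkin variants): `B_H(uH,v) = F(v)` for all `v ∈ WH`. -/
def IsMsFEMSolution (VH WH : Submodule ℝ (Euc d → ℝ)) (uH : Euc d → ℝ) : Prop :=
  uH ∈ VH ∧ ∀ v ∈ WH, ∀ t, T.HasBrokenTrace v t → P.BH T uH v = P.load v t

/-- `uhand` is the handbook function: `uhand ∈ H^1_0(Ωhand)` and
`B^*(uhand,v) = Q(v)` for all `v ∈ H^1_0(Ωhand)`. -/
def IsHandbook (fQ : Euc d → ℝ) (qQ : Euc d → Euc d) (Ωhand : Set (Euc d))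
    (uhand : Euc d → ℝ) : Prop :=
  MemH10 Ωhand uhand ∧ ∀ v, MemH10 Ωhand v →
    ∫ x in Ωhand, inner ℝ (act (P.A x) (wgrad Ωhand v x)) (wgrad Ωhand uhand x)
      = ∫ x in Ωhand, (fQ x * v x + inner ℝ (qQ x) (wgrad Ωhand v x))

/-- `ures ∈ VH` solves the residual adjoint problem
`B^*(ures,v) = Q(v) - B^*(w,v)` for all `v ∈ WH` (forms understood in the broken sense). -/
def IsMsFEMResidual (fQ : Euc d → ℝ) (qQ : Euc d → Euc d) (VH WH : Submodule ℝ (Euc d → ℝ))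
    (w ures : Euc d → ℝ) : Prop :=
  ures ∈ VH ∧ ∀ v ∈ WH, P.BH T v ures = P.QH T fQ qQ v - P.BH T v w

/-- The residual adjoint loading
`-∫_{∂Ω₁} ((A∇uhand - q_Q)·n) v - ∫_{Ω₂} A∇w·∇v`. -/
def resLoad (qQ : Euc d → Euc d) (Ω₁ Ω₂ : Set (Euc d)) (uhand w v : Euc d → ℝ) : ℝ :=
  - normalPairing Ω₁ (fun x => P.flux uhand x - qQ x) v
    - ∫ x in Ω₂, inner ℝ (P.flux w x) (wgrad P.Ω v x)

/-- The fluxes equilibrated with the residual adjoint loading. -/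
def MemSRes (qQ : Euc d → Euc d) (Ω₁ Ω₂ : Set (Euc d)) (uhand w : Euc d → ℝ)
    (p : Euc d → Euc d) : Prop :=
  MemLp p 2 (volume.restrict P.Ω) ∧ ∀ v, P.MemV v →
    ∫ x in P.Ω, inner ℝ (p x) (wgrad P.Ω v x) = P.resLoad qQ Ω₁ Ω₂ uhand w v

/-- The correction term
`(1/2) ∫_Ω A⁻¹ (q - A∇u) · (qadj + A∇uadj)`. -/
def Cbar (u : Euc d → ℝ) (q : Euc d → Euc d) (uadj : Euc d → ℝ) (qadj : Euc d → Euc d) : ℝ :=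
  (1 / 2) * ∫ x in P.Ω,
    inner ℝ (act (P.A x)⁻¹ (q x - P.flux u x)) (qadj x + P.flux uadj x)

end ModelProblem

/-- `max_{θ = ±1} |D + C + (θ/2) E₁ E₂|`. -/
def etaQ (D C E₁ E₂ : ℝ) : ℝ :=
  max |D + C + (1 / 2) * (E₁ * E₂)| |D + C + (-1 / 2) * (E₁ * E₂)|

end MsFEM

end

namespace MsFEM

/-! ### Square integrable fields -/

section L2

variable {X E : Type*} [MeasurableSpace X] {μ : Measure X} [NormedAddCommGroup E]
  [InnerProductSpace ℝ E]

/-! The bound is a Prager–Synge (hypercircle) argument in the inner product `⟨F, G⟩ = ∫ A⁻¹F·G`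
(`invInner`), for which `⟨p, A∇v⟩ = ∫ p·∇v`. Write `e = u - uhat`, `r = qhat - A∇uhat`, `z = uplus`,
`p = qplus`. Since `qhat` and `A∇u` balance the same load, `r - A∇e` is orthogonal to `A∇v` for all
`v ∈ V`. Hence `Q(u) - Q(uhat) - Cbar = ⟨p - A∇z, A∇e - r/2⟩`, and the second factor has norm
exactly `‖r‖/2`, so Cauchy–Schwarz gives the constant `1/2` (`abs_Q_sub_Cbar_le`). The term `ΔQ`
converts `Q(uhat)` into the broken value at `uH`.

This requires `z ∈ V` and `∫ p·∇v = Q(v)` on `V`. The function `Σ` is Lipschitz on segments inside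
`Ω` and takes values in `[0,1]` (`isCutoff_pum`), so multiplication by `Σ` is continuous in `H^1`.
Approximating `uhand` by test functions then gives `w ∈ V`, with zero trace on the whole boundary
(`MemH10.hasTrace_mul`). At points of `Ω` where `Σ` is `0` or `1` it has an interior extremum and
its gradient vanishes, so `A∇w` is `A∇uhand` on `Ω₁`, unrestricted on `Ω₂`, and zero elsewhere, up
to null sets (`Bstar_enrichment`). The handbook equation gives `div (A∇uhand - qQ) = -fQ` in `Ω₁`,
and Green's formula turns `Q - B*(w, ·)` into the residual load (`IsHandbook.normalPairing_eq`).
Adding `A∇w` to a flux that balances this load yields an adjoint equilibrated flux, and the same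
`A∇w` cancels in the constitutive relation error. -/

theorem integrable_inner_of_memLp {p q : X → E} (hp : MemLp p 2 μ) (hq : MemLp q 2 μ) :
    Integrable (fun x => (inner ℝ (p x) (q x) : ℝ)) μ := by
  rw [← memLp_one_iff_integrable]
  refine ⟨hp.1.inner hq.1, ?_⟩
  have h := eLpNorm_le_eLpNorm_mul_eLpNorm_of_nnnorm (p := 2) (q := 2) (r := 1) hp.1 hq.1
    (fun a b => (inner ℝ a b : ℝ)) 1
    (Eventually.of_forall fun x => by simpa using nnnorm_inner_le_nnnorm (𝕜 := ℝ) (p x) (q x))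
  exact h.trans_lt (ENNReal.mul_lt_top (ENNReal.mul_lt_top (by simp) hp.2) hq.2)

theorem integrable_mul_of_memLp {p q : X → ℝ} (hp : MemLp p 2 μ) (hq : MemLp q 2 μ) :
    Integrable (fun x => p x * q x) μ :=
  hp.integrable_mul hq

theorem tendsto_integral_inner {F : ℕ → X → E} {f g : X → E} (hF : ∀ n, MemLp (F n) 2 μ)
    (hf : MemLp f 2 μ) (hg : MemLp g 2 μ)
    (h : Tendsto (fun n => eLpNorm (F n - f) 2 μ) atTop (𝓝 0)) :
    Tendsto (fun n => ∫ x, (inner ℝ (F n x) (g x) : ℝ) ∂μ) atTop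
      (𝓝 (∫ x, inner ℝ (f x) (g x) ∂μ)) := by
  refine tendsto_integral_of_L1' _ (integrable_inner_of_memLp hf hg).1
    (Eventually.of_forall fun n => integrable_inner_of_memLp (hF n) hg) ?_
  have hb : ∀ n, eLpNorm ((fun x => (inner ℝ (F n x) (g x) : ℝ)) - fun x => inner ℝ (f x) (g x))
      1 μ ≤ eLpNorm (F n - f) 2 μ * eLpNorm g 2 μ := by
    intro n
    have h := eLpNorm_le_eLpNorm_mul_eLpNorm_of_nnnorm (p := 2) (q := 2) (r := 1)
      ((hF n).sub hf).1 hg.1 (fun a b => (inner ℝ a b : ℝ)) 1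
      (Eventually.of_forall fun x => by
        simpa using nnnorm_inner_le_nnnorm (𝕜 := ℝ) ((F n - f) x) (g x))
    simp only [ENNReal.coe_one, one_mul] at h
    refine le_trans (le_of_eq ?_) h
    congr 1
    ext x
    simp [inner_sub_left]
  have h0 : Tendsto (fun n => eLpNorm (F n - f) 2 μ * eLpNorm g 2 μ) atTop (𝓝 0) := by
    simpa using ENNReal.Tendsto.mul_const h (Or.inr hg.2.ne)
  exact tendsto_of_tendsto_of_tendsto_of_le_of_le tendsto_const_nhds h0 (fun _ => zero_le)
    hb

theorem tendsto_integral_mul {F : ℕ → X → ℝ} {f g : X → ℝ} (hF : ∀ n, MemLp (F n) 2 μ)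
    (hf : MemLp f 2 μ) (hg : MemLp g 2 μ)
    (h : Tendsto (fun n => eLpNorm (F n - f) 2 μ) atTop (𝓝 0)) :
    Tendsto (fun n => ∫ x, F n x * g x ∂μ) atTop (𝓝 (∫ x, f x * g x ∂μ)) := by
  simpa [mul_comm] using tendsto_integral_inner hF hf hg h

end L2

variable {d : ℕ}

section Sobolev

variable {U W : Set (Euc d)}

/-! ### Test functions -/

namespace IsTest

variable {φ ψ : Euc d → ℝ}

theorem mono (h : IsTest U φ) (hUW : U ⊆ W) : IsTest W φ := ⟨h.1, h.2.1, h.2.2.trans hUW⟩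

theorem eq_zero (h : IsTest U φ) {x : Euc d} (hx : x ∉ U) : φ x = 0 :=
  image_eq_zero_of_notMem_tsupport fun h' => hx (h.2.2 h')

theorem fderiv_eq_zero (h : IsTest U φ) {x : Euc d} (hx : x ∉ U) : fderiv ℝ φ x = 0 :=
  image_eq_zero_of_notMem_tsupport fun h' => hx (h.2.2 (tsupport_fderiv_subset ℝ h'))

theorem mul (h : IsTest U φ) (h' : IsTest W ψ) : IsTest U (fun x => φ x * ψ x) :=
  ⟨h.1.mul h'.1, h.2.1.mul_right, (tsupport_mul_subset_left).trans h.2.2⟩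

theorem differentiable (h : IsTest U φ) : Differentiable ℝ φ := h.1.differentiable (by simp)

theorem continuous_fderiv (h : IsTest U φ) : Continuous (fderiv ℝ φ) :=
  h.1.continuous_fderiv (by simp)

theorem memLp (h : IsTest U φ) (s : Set (Euc d)) (p : ℝ≥0∞) :
    MemLp φ p (volume.restrict s) :=
  (h.1.continuous.memLp_of_hasCompactSupport h.2.1).restrict s

theorem memLp_fderiv (h : IsTest U φ) (s : Set (Euc d)) (p : ℝ≥0∞) (e : Euc d) :
    MemLp (fun x => fderiv ℝ φ x e) p (volume.restrict s) :=
  ((h.continuous_fderiv.clm_apply continuous_const).memLp_of_hasCompactSupport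
    (h.2.1.fderiv_apply ℝ e)).restrict s

theorem continuous_gradient (h : IsTest U φ) : Continuous (gradient φ) :=
  (LinearIsometryEquiv.continuous _).comp h.continuous_fderiv

theorem memLp_gradient (h : IsTest U φ) (s : Set (Euc d)) (p : ℝ≥0∞) :
    MemLp (gradient φ) p (volume.restrict s) := by
  refine (h.continuous_gradient.memLp_of_hasCompactSupport ?_).restrict s
  exact (h.2.1.fderiv ℝ).comp_left (g := (InnerProductSpace.toDual ℝ (Euc d)).symm) (map_zero _)

theorem gradient_eq_zero (h : IsTest U φ) {x : Euc d} (hx : x ∉ U) : gradient φ x = 0 := by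
  simp [gradient, h.fderiv_eq_zero hx]

end IsTest

theorem inner_gradient (φ : Euc d → ℝ) (x e : Euc d) :
    inner ℝ (gradient φ x) e = fderiv ℝ φ x e :=
  InnerProductSpace.toDual_symm_apply

theorem measurable_gradient (φ : Euc d → ℝ) : Measurable (gradient φ) :=
  (LinearIsometryEquiv.continuous _).measurable.comp (measurable_fderiv ℝ φ)

theorem ae_eq_zero_of_forall_isTest {E : Type*} [NormedAddCommGroup E] [NormedSpace ℝ E]
    [CompleteSpace E] (hU : IsOpen U) {f : Euc d → E} (hf : MemLp f 2 (volume.restrict U))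
    (h : ∀ φ, IsTest U φ → ∫ x in U, φ x • f x = 0) : f =ᵐ[volume.restrict U] 0 := by
  have h1 : LocallyIntegrableOn f U volume :=
    locallyIntegrableOn_of_locallyIntegrable_restrict (hf.locallyIntegrable (by norm_num))
  have := hU.ae_eq_zero_of_integral_contDiff_smul_eq_zero h1 (fun g hg hc hs => by
    rw [← h g ⟨hg, hc, hs⟩, setIntegral_eq_integral_of_forall_compl_eq_zero]
    intro x hx
    rw [IsTest.eq_zero (U := U) ⟨hg, hc, hs⟩ hx, zero_smul])
  exact (ae_restrict_iff' hU.measurableSet).2 this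

/-! ### Weak gradients -/

section WeakGrad

variable {u v : Euc d → ℝ} {G H : Euc d → Euc d}

theorem setIntegral_eq_of_vanish {f : Euc d → ℝ} (hW : MeasurableSet W) (hUW : U ⊆ W)
    (h : ∀ x, x ∉ U → f x = 0) : ∫ x in W, f x = ∫ x in U, f x :=
  setIntegral_eq_of_subset_of_forall_sdiff_eq_zero hW hUW fun x hx => h x hx.2

theorem HasWeakGrad.mono (h : HasWeakGrad W u G) (hW : IsOpen W) (hUW : U ⊆ W) :
    HasWeakGrad U u G := by
  intro φ hφ e
  have := h φ (hφ.mono hUW) e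
  rwa [setIntegral_eq_of_vanish hW.measurableSet hUW fun x hx => by simp [hφ.fderiv_eq_zero hx],
    setIntegral_eq_of_vanish hW.measurableSet hUW fun x hx => by simp [hφ.eq_zero hx]] at this

theorem memLp_inner_const {μ : Measure (Euc d)} {p : ℝ≥0∞} (hG : MemLp G p μ) (e : Euc d) :
    MemLp (fun x => (inner ℝ (G x) e : ℝ)) p μ := by
  simpa [real_inner_comm] using hG.const_inner (𝕜 := ℝ) e

/-- The combination `u + c • v` covers sums and differences at once; `c = 1` and `c = -1` are the
cases needed later. -/
theorem HasWeakGrad.add_smul (hu : HasWeakGrad U u G) (hv : HasWeakGrad U v H) (c : ℝ)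
    (mu : MemLp u 2 (volume.restrict U)) (mv : MemLp v 2 (volume.restrict U))
    (mG : MemLp G 2 (volume.restrict U)) (mH : MemLp H 2 (volume.restrict U)) :
    HasWeakGrad U (u + c • v) (G + c • H) := by
  intro φ hφ e
  have h1 := hu φ hφ e
  have h2 := hv φ hφ e
  have i1 := integrable_mul_of_memLp mu (hφ.memLp_fderiv U 2 e)
  have i2 := integrable_mul_of_memLp mv (hφ.memLp_fderiv U 2 e)
  have i3 := integrable_mul_of_memLp (hφ.memLp U 2) (memLp_inner_const mG e)
  have i4 := integrable_mul_of_memLp (hφ.memLp U 2) (memLp_inner_const mH e)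
  have e1 : ∀ x, (u + c • v) x * fderiv ℝ φ x e
      = u x * fderiv ℝ φ x e + c * (v x * fderiv ℝ φ x e) := fun x => by
    simp; ring
  have e2 : ∀ x, φ x * inner ℝ ((G + c • H) x) e
      = φ x * inner ℝ (G x) e + c * (φ x * inner ℝ (H x) e) := fun x => by
    simp [inner_add_left, inner_smul_left]; ring
  simp_rw [e1, e2]
  rw [integral_add i1 (i2.const_mul c), integral_add i3 (i4.const_mul c), integral_const_mul,
    integral_const_mul, h1, h2]
  ring

theorem HasWeakGrad.ae_eq (hU : IsOpen U) (h : HasWeakGrad U u G) (h' : HasWeakGrad U u H)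
    (mG : MemLp G 2 (volume.restrict U)) (mH : MemLp H 2 (volume.restrict U)) :
    G =ᵐ[volume.restrict U] H := by
  have := ae_eq_zero_of_forall_isTest hU (mG.sub mH) (fun φ hφ => by
    have hi : ∀ F : Euc d → Euc d, MemLp F 2 (volume.restrict U) →
        Integrable (fun x => φ x • F x) (volume.restrict U) := fun F mF =>
      memLp_one_iff_integrable.1 (mF.smul (p := 2) (q := 2) (hφ.memLp U 2))
    refine ext_inner_right ℝ fun e => ?_
    rw [← real_inner_comm, ← integral_inner (hi _ (mG.sub mH)), inner_zero_left]
    have e1 : ∀ x, (inner ℝ e (φ x • (G - H) x) : ℝ)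
        = φ x * inner ℝ (G x) e - φ x * inner ℝ (H x) e := fun x => by
      simp [inner_smul_right, inner_sub_right, real_inner_comm]; ring
    simp_rw [e1]
    rw [integral_sub (integrable_mul_of_memLp (hφ.memLp U 2) (memLp_inner_const mG e))
      (integrable_mul_of_memLp (hφ.memLp U 2) (memLp_inner_const mH e))]
    linarith [h φ hφ e, h' φ hφ e])
  filter_upwards [this] with x hx
  exact sub_eq_zero.1 hx

theorem MemH1.memLp_wgrad (h : MemH1 U u) : MemLp (wgrad U u) 2 (volume.restrict U) := by
  rw [wgrad, dif_pos h]
  exact h.2.choose_spec.1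

theorem MemH1.hasWeakGrad (h : MemH1 U u) : HasWeakGrad U u (wgrad U u) := by
  rw [wgrad, dif_pos h]
  exact h.2.choose_spec.2

theorem HasWeakGrad.memH1 (h : HasWeakGrad U u G) (mu : MemLp u 2 (volume.restrict U))
    (mG : MemLp G 2 (volume.restrict U)) : MemH1 U u := ⟨mu, G, mG, h⟩

/-- `wgrad` is an arbitrary choice, so it is computed by exhibiting some weak gradient and invoking
uniqueness. This is why all its identities hold only almost everywhere. -/
theorem HasWeakGrad.wgrad_ae_eq (h : HasWeakGrad U u G) (hU : IsOpen U)
    (mu : MemLp u 2 (volume.restrict U)) (mG : MemLp G 2 (volume.restrict U)) :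
    wgrad U u =ᵐ[volume.restrict U] G :=
  (h.memH1 mu mG).hasWeakGrad.ae_eq hU h (h.memH1 mu mG).memLp_wgrad mG

theorem MemH1.mono (h : MemH1 W u) (hW : IsOpen W) (hUW : U ⊆ W) : MemH1 U u :=
  (h.hasWeakGrad.mono hW hUW).memH1 (h.1.mono_measure (Measure.restrict_mono hUW le_rfl))
    (h.memLp_wgrad.mono_measure (Measure.restrict_mono hUW le_rfl))

theorem MemH1.wgrad_mono (h : MemH1 W u) (hW : IsOpen W) (hU : IsOpen U) (hUW : U ⊆ W) :
    wgrad U u =ᵐ[volume.restrict U] wgrad W u :=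
  (h.hasWeakGrad.mono hW hUW).wgrad_ae_eq hU (h.1.mono_measure (Measure.restrict_mono hUW le_rfl))
    (h.memLp_wgrad.mono_measure (Measure.restrict_mono hUW le_rfl))

theorem MemH1.add_smul (hu : MemH1 U u) (hv : MemH1 U v) (c : ℝ) : MemH1 U (u + c • v) :=
  (hu.hasWeakGrad.add_smul hv.hasWeakGrad c hu.1 hv.1 hu.memLp_wgrad hv.memLp_wgrad).memH1
    (hu.1.add (hv.1.const_smul c)) (hu.memLp_wgrad.add (hv.memLp_wgrad.const_smul c))

theorem MemH1.wgrad_add_smul (hU : IsOpen U) (hu : MemH1 U u) (hv : MemH1 U v) (c : ℝ) :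
    wgrad U (u + c • v) =ᵐ[volume.restrict U] wgrad U u + c • wgrad U v :=
  (hu.hasWeakGrad.add_smul hv.hasWeakGrad c hu.1 hv.1 hu.memLp_wgrad hv.memLp_wgrad).wgrad_ae_eq hU
    (hu.1.add (hv.1.const_smul c)) (hu.memLp_wgrad.add (hv.memLp_wgrad.const_smul c))

theorem MemH1.wgrad_sub (hU : IsOpen U) (hu : MemH1 U u) (hv : MemH1 U v) :
    wgrad U (u - v) =ᵐ[volume.restrict U] wgrad U u - wgrad U v := by
  simpa [sub_eq_add_neg] using hu.wgrad_add_smul hU hv (-1)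

/-- Weak gradients pass to the limit in `L^2`. -/
theorem HasWeakGrad.of_tendsto {uₙ : ℕ → Euc d → ℝ} {Gₙ : ℕ → Euc d → Euc d}
    (h : ∀ n, HasWeakGrad U (uₙ n) (Gₙ n))
    (mun : ∀ n, MemLp (uₙ n) 2 (volume.restrict U)) (mGn : ∀ n, MemLp (Gₙ n) 2 (volume.restrict U))
    (mu : MemLp u 2 (volume.restrict U)) (mG : MemLp G 2 (volume.restrict U))
    (hu : Tendsto (fun n => eLpNorm (uₙ n - u) 2 (volume.restrict U)) atTop (𝓝 0))
    (hG : Tendsto (fun n => eLpNorm (Gₙ n - G) 2 (volume.restrict U)) atTop (𝓝 0)) :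
    HasWeakGrad U u G := by
  intro φ hφ e
  have h1 := tendsto_integral_mul mun mu (hφ.memLp_fderiv U 2 e) hu
  have h2 := tendsto_integral_inner mGn mG
    (MemLp.smul (p := 2) (q := ∞) (r := 2) (memLp_top_const e) (hφ.memLp U 2)) hG
  have e2 : ∀ F : Euc d → Euc d, ∀ x, (inner ℝ (F x) ((φ • fun _ => e) x) : ℝ)
      = φ x * inner ℝ (F x) e := fun F x => by
    simp [inner_smul_right]
  simp_rw [e2] at h2
  refine tendsto_nhds_unique h1 ?_
  simp_rw [fun n => h n φ hφ e]
  exact h2.neg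

/-- The set `s` need not be related to `U`: the competing test function vanishes off `s`, so both
integrals extend to the whole space, where integration by parts has no boundary term. -/
theorem IsTest.hasWeakGrad {φ : Euc d → ℝ} (h : IsTest U φ) (s : Set (Euc d)) :
    HasWeakGrad s φ (gradient φ) := by
  intro ψ hψ e
  rw [setIntegral_eq_integral_of_forall_compl_eq_zero fun x hx => by
      simp [hψ.fderiv_eq_zero hx],
    setIntegral_eq_integral_of_forall_compl_eq_zero fun x hx => by simp [hψ.eq_zero hx]]
  simp_rw [inner_gradient]
  have hc := (h.mono (subset_univ U))
  have hc' := (hψ.mono (subset_univ s))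
  have i1 : Integrable (fun x => fderiv ℝ φ x e * ψ x) := by
    have := integrable_mul_of_memLp (hc.memLp_fderiv univ 2 e) (hc'.memLp univ 2)
    simpa using this
  have i2 : Integrable (fun x => φ x * fderiv ℝ ψ x e) := by
    have := integrable_mul_of_memLp (hc.memLp univ 2) (hc'.memLp_fderiv univ 2 e)
    simpa using this
  have i3 : Integrable (fun x => φ x * ψ x) := by
    have := integrable_mul_of_memLp (hc.memLp univ 2) (hc'.memLp univ 2)
    simpa using this
  have := integral_mul_fderiv_eq_neg_fderiv_mul_of_integrable i1 i2 i3
    (fun x _ => h.differentiable x) (fun x _ => hψ.differentiable x)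
  simpa [mul_comm] using this

theorem IsTest.memH1 {φ : Euc d → ℝ} (h : IsTest U φ) (s : Set (Euc d)) : MemH1 s φ :=
  (h.hasWeakGrad s).memH1 (h.memLp s 2) (h.memLp_gradient s 2)

theorem IsTest.wgrad_ae_eq {φ : Euc d → ℝ} (h : IsTest U φ) {s : Set (Euc d)} (hs : IsOpen s) :
    wgrad s φ =ᵐ[volume.restrict s] gradient φ :=
  (h.hasWeakGrad s).wgrad_ae_eq hs (h.memLp s 2) (h.memLp_gradient s 2)

theorem IsTest.memH10 {φ : Euc d → ℝ} (h : IsTest U φ) : MemH10 U φ :=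
  ⟨fun _ hx => h.eq_zero hx, h.memH1 U, fun _ => φ, fun _ => h, by simp [TendstoH1]⟩

theorem wdiv_ae_eq {p : Euc d → Euc d} {D : Euc d → ℝ} (hU : IsOpen U)
    (mp : MemLp p 2 (volume.restrict U)) (mD : MemLp D 2 (volume.restrict U))
    (h : HasWeakDiv U p D) : wdiv U p =ᵐ[volume.restrict U] D := by
  have hp : MemHdiv U p := ⟨mp, D, mD, h⟩
  rw [wdiv, dif_pos hp]
  obtain ⟨m', h'⟩ := hp.2.choose_spec
  have := ae_eq_zero_of_forall_isTest hU (m'.sub mD) (fun φ hφ => by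
    have e1 : ∀ x, φ x • (hp.2.choose - D) x = hp.2.choose x * φ x - D x * φ x := fun x => by
      simp; ring
    simp_rw [e1]
    rw [integral_sub (integrable_mul_of_memLp m' (hφ.memLp U 2))
      (integrable_mul_of_memLp mD (hφ.memLp U 2))]
    linarith [h φ hφ, h' φ hφ])
  filter_upwards [this] with x hx
  exact sub_eq_zero.1 hx

/-! ### Traces -/

theorem tendsto_eLpNorm_add_smul {X E : Type*} [MeasurableSpace X] {μ : Measure X}
    [NormedAddCommGroup E] [NormedSpace ℝ E] {f g : ℕ → X → E}
    (mf : ∀ n, AEStronglyMeasurable (f n) μ) (mg : ∀ n, AEStronglyMeasurable (g n) μ) (c : ℝ)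
    (hf : Tendsto (fun n => eLpNorm (f n) 2 μ) atTop (𝓝 0))
    (hg : Tendsto (fun n => eLpNorm (g n) 2 μ) atTop (𝓝 0)) :
    Tendsto (fun n => eLpNorm (f n + c • g n) 2 μ) atTop (𝓝 0) := by
  have h0 : Tendsto (fun n => eLpNorm (f n) 2 μ + ‖c‖ₑ * eLpNorm (g n) 2 μ) atTop (𝓝 0) := by
    simpa using hf.add (ENNReal.Tendsto.const_mul hg (Or.inr (by simp)))
  refine tendsto_of_tendsto_of_tendsto_of_le_of_le tendsto_const_nhds h0 (fun _ => zero_le)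
    fun n => ?_
  refine (eLpNorm_add_le (mf n) ((mg n).const_smul c) (by norm_num)).trans ?_
  rw [eLpNorm_const_smul]

theorem TendstoH1.add_smul {uₙ vₙ : ℕ → Euc d → ℝ} (hU : IsOpen U) (hun : ∀ n, MemH1 U (uₙ n))
    (hvn : ∀ n, MemH1 U (vₙ n)) (hu : MemH1 U u) (hv : MemH1 U v) (h : TendstoH1 U uₙ u)
    (h' : TendstoH1 U vₙ v) (c : ℝ) : TendstoH1 U (fun n => uₙ n + c • vₙ n) (u + c • v) := by
  constructor
  · have := tendsto_eLpNorm_add_smul (fun n => ((hun n).1.sub hu.1).1)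
      (fun n => ((hvn n).1.sub hv.1).1) c h.1 h'.1
    refine this.congr fun n => ?_
    congr 1
    ext x
    simp
    ring
  · have := tendsto_eLpNorm_add_smul (fun n => ((hun n).memLp_wgrad.sub hu.memLp_wgrad).1)
      (fun n => ((hvn n).memLp_wgrad.sub hv.memLp_wgrad).1) c h.2 h'.2
    refine this.congr fun n => eLpNorm_congr_ae ?_
    filter_upwards [(hun n).wgrad_add_smul hU (hvn n) c, hu.wgrad_add_smul hU hv c] with x h1 h2
    simp only [Pi.sub_apply, Pi.add_apply, Pi.smul_apply, h1, h2]
    module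

theorem HasTrace.add_smul {t s : Euc d → ℝ} (hU : IsOpen U) (h : HasTrace U u t)
    (h' : HasTrace U v s) (c : ℝ) : HasTrace U (u + c • v) (t + c • s) := by
  obtain ⟨hu, ht, uₙ, hun, hc, hb⟩ := h
  obtain ⟨hv, hs, vₙ, hvn, hc', hb'⟩ := h'
  refine ⟨hu.add_smul hv c, ht.add (hs.const_smul c), fun n => uₙ n + c • vₙ n,
    fun n => ⟨(hun n).1.add ((hvn n).1.const_smul c), (hun n).2.add_smul (hvn n).2 c⟩,
    hc.add_smul hU (fun n => (hun n).2) (fun n => (hvn n).2) hu hv hc' c, ?_⟩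
  have hmeas : ∀ {w : Euc d → ℝ}, ContinuousOn w (closure U) →
      AEStronglyMeasurable w ((surf d).restrict (frontier U)) := fun hw =>
    (hw.mono frontier_subset_closure).aestronglyMeasurable isClosed_frontier.measurableSet
  have := tendsto_eLpNorm_add_smul (fun n => (hmeas (hun n).1).sub ht.1)
      (fun n => (hmeas (hvn n).1).sub hs.1) c hb hb'
  refine this.congr fun n => ?_
  congr 1
  ext x
  simp
  ring

end WeakGrad

theorem ModelProblem.MemVWith.add_smul {P : ModelProblem d} {u v t s : Euc d → ℝ}
    (h : P.MemVWith u t) (h' : P.MemVWith v s) (c : ℝ) :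
    P.MemVWith (u + c • v) (t + c • s) := by
  refine ⟨h.1.add_smul P.isOpen h'.1 c, ?_⟩
  filter_upwards [h.2, h'.2] with x h1 h2
  simp [h1, h2]

theorem ModelProblem.MemV.add_smul {P : ModelProblem d} {u v : Euc d → ℝ} (h : P.MemV u)
    (h' : P.MemV v) (c : ℝ) : P.MemV (u + c • v) := by
  obtain ⟨t, ht⟩ := h
  obtain ⟨s, hs⟩ := h'
  exact ⟨_, ht.add_smul hs c⟩

theorem ModelProblem.MemV.memH1 {P : ModelProblem d} {u : Euc d → ℝ} (h : P.MemV u) :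
    MemH1 P.Ω u := h.choose_spec.1.1

end Sobolev

/-! ### Mesh elements -/

namespace Cell

theorem isCompact_closed (K : Cell d) : IsCompact K.closed := by
  cases K with
  | simplex b => exact (finite_range b).isCompact_convexHull ℝ
  | box p b =>
    have h : (box p b).closed = (fun y => p + b.equivFun.symm y) '' Icc (0 : Fin d → ℝ) 1 := by
      ext x
      constructor
      · intro hx
        refine ⟨b.equivFun (x - p), ⟨fun j => (hx j).1, fun j => (hx j).2⟩, ?_⟩
        change p + b.equivFun.symm (b.equivFun (x - p)) = x
        rw [LinearEquiv.symm_apply_apply, add_sub_cancel]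
      · rintro ⟨y, hy, rfl⟩ j
        have : b.repr (p + b.equivFun.symm y - p) j = y j := by
          rw [add_sub_cancel_left, ← b.equivFun_apply, LinearEquiv.apply_symm_apply]
        rw [this]
        exact ⟨hy.1 j, hy.2 j⟩
    rw [h]
    exact isCompact_Icc.image
      (continuous_const.add b.equivFun.symm.toLinearMap.continuous_of_finiteDimensional)

theorem isClosed_closed (K : Cell d) : IsClosed K.closed := K.isCompact_closed.isClosed

theorem convex_closed (K : Cell d) : Convex ℝ K.closed := by
  cases K with
  | simplex b => exact convex_convexHull ℝ _
  | box p b =>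
    intro x hx y hy s t hs ht hst j
    have h : b.repr (s • x + t • y - p) j = s * b.repr (x - p) j + t * b.repr (y - p) j := by
      have : s • x + t • y - p = s • (x - p) + t • (y - p) := by
        have : p = (s + t) • p := by rw [hst, one_smul]
        nth_rewrite 1 [this]
        module
      rw [this]
      simp
    rw [h]
    exact convex_Icc (0 : ℝ) 1 (hx j) (hy j) hs ht hst

theorem isOpen_carrier (K : Cell d) : IsOpen K.carrier := isOpen_interior

/-- The frontier of a convex set is Lebesgue-null; this treats both element types together. -/
theorem volume_closed_diff_carrier (K : Cell d) : volume (K.closed \ K.carrier) = 0 :=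
  measure_mono_null (K.isClosed_closed.frontier_eq.symm.subset :)
    (K.convex_closed.addHaar_frontier volume)

theorem contDiff_shape (K : Cell d) (s : Euc d) : ContDiff ℝ 1 (K.shape s) := by
  classical
  cases K with
  | simplex b =>
    refine ContDiff.sum fun i _ => ?_
    split_ifs
    · exact ContinuousAffineMap.contDiff
        ⟨b.coord i, AffineMap.continuous_of_finiteDimensional _⟩
    · exact contDiff_const
  | box p b =>
    refine ContDiff.sum fun σ _ => ?_
    have hc : ∀ j, ContDiff ℝ 1 fun x => b.repr (x - p) j := fun j =>
      (LinearMap.toContinuousLinearMap (b.coord j)).contDiff.comp (contDiff_id.sub contDiff_const)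
    split_ifs
    · refine contDiff_prod fun j _ => ?_
      split_ifs
      · exact hc j
      · exact contDiff_const.sub (hc j)
    · exact contDiff_const

theorem exists_lipschitzOnWith_sum_shape (K : Cell d) (S : Finset (Euc d)) :
    ∃ C, LipschitzOnWith C (fun x => ∑ s ∈ S, K.shape s x) K.closed :=
  (ContDiff.sum fun s _ => K.contDiff_shape s).contDiffOn.exists_lipschitzOnWith one_ne_zero
    K.convex_closed K.isCompact_closed

open Classical in
-- After exchanging the sums, what remains is the partial sum of the weights `a i` with `v i ∈ S`,
-- for nonnegative weights of total `1`.
theorem sum_ite_mem_Icc {ι : Type*} [Fintype ι] (v : ι → Euc d) (a : ι → ℝ) (ha : ∀ i, 0 ≤ a i)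
    (h1 : ∑ i, a i = 1) (S : Finset (Euc d)) :
    ∑ s ∈ S, ∑ i, (if v i = s then a i else 0) ∈ Icc (0 : ℝ) 1 := by
  rw [Finset.sum_comm]
  simp_rw [Finset.sum_ite_eq]
  constructor
  · exact Finset.sum_nonneg fun i _ => by split_ifs; exacts [ha i, le_rfl]
  · rw [← h1]
    exact Finset.sum_le_sum fun i _ => by split_ifs; exacts [le_rfl, ha i]

theorem sum_shape_mem_Icc (K : Cell d) (S : Finset (Euc d)) {x : Euc d} (hx : x ∈ K.closed) :
    ∑ s ∈ S, K.shape s x ∈ Icc (0 : ℝ) 1 := by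
  cases K with
  | simplex b =>
    have hx' : ∀ i, 0 ≤ b.coord i x := by
      have : x ∈ convexHull ℝ (range b) := hx
      rwa [b.convexHull_eq_nonneg_coord] at this
    exact sum_ite_mem_Icc b _ hx' (b.sum_coord_apply_eq_one x) S
  | box p b =>
    refine sum_ite_mem_Icc (boxVertex p b)
      (fun σ => ∏ j, (if σ j then b.repr (x - p) j else 1 - b.repr (x - p) j)) (fun σ => ?_) ?_ S
    · refine Finset.prod_nonneg fun j _ => ?_
      split_ifs
      · exact (hx j).1
      · exact sub_nonneg.2 (hx j).2
    -- Partition of unity on a parallelotope: expanding `∏ j, (t j + (1 - t j)) = 1` produces one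
    -- term for each vertex `σ`.
    · have := Finset.prod_univ_sum (fun _ : Fin d => (Finset.univ : Finset Bool))
        (fun j τ => if τ then b.repr (x - p) j else 1 - b.repr (x - p) j)
      rw [Fintype.piFinset_univ] at this
      rw [← this]
      simp

end Cell

/-! ### Piecewise Lipschitz functions -/

/-- Continuous induction along the segment: the parameters `t` with `|f a - f (γ t)| ≤ C t |a - b|`
form a closed set, and from each of them one can advance to the right inside a single piece. No
structure of the intersections of the segment with the pieces is needed. -/
theorem dist_le_of_segment_subset {ι : Type*} [Finite ι] {S : ι → Set (Euc d)}
    (hS : ∀ k, IsClosed (S k)) {f : Euc d → ℝ} {C : NNReal} (hf : ∀ k, LipschitzOnWith C f (S k))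
    {a b : Euc d} (hab : segment ℝ a b ⊆ ⋃ k, S k) : dist (f a) (f b) ≤ C * dist a b := by
  set γ : ℝ →ᵃ[ℝ] Euc d := AffineMap.lineMap a b with hγ
  have hγc : Continuous γ := AffineMap.lineMap_continuous
  have hγm : ∀ t ∈ Icc (0 : ℝ) 1, γ t ∈ ⋃ k, S k := fun t ht => hab (by
    rw [segment_eq_image_lineMap]; exact mem_image_of_mem _ ht)
  have hfc : ContinuousOn f (⋃ k, S k) :=
    (locallyFinite_of_finite S).continuousOn_iUnion hS fun k => (hf k).continuousOn
  have hfγ : ContinuousOn (fun t => dist (f a) (f (γ t))) (Icc 0 1) :=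
    (continuous_const.dist continuous_id).comp_continuousOn (hfc.comp hγc.continuousOn hγm)
  let s : Set ℝ := {t | dist (f a) (f (γ t)) ≤ C * (t * dist a b)}
  have hs : IsClosed (s ∩ Icc 0 1) := by
    have := isClosed_Icc.isClosed_le (g := fun t => (C : ℝ) * (t * dist a b)) hfγ (by fun_prop)
    convert! this using 1
    ext t
    exact and_comm
  have h0 : (0 : ℝ) ∈ s := by simp [s, hγ]
  have h1 : Icc (0 : ℝ) 1 ⊆ s := by
    refine hs.Icc_subset_of_forall_exists_gt h0 ?_
    rintro t ⟨hts, ht0, ht1⟩ y hy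
    -- There are finitely many pieces, so one of them contains `γ t'` for `t'` arbitrarily close to
    -- `t` on the right; being closed, it contains `γ t` too.
    obtain ⟨k, hk⟩ : ∃ k, ∃ᶠ t' in 𝓝[>] t, γ t' ∈ S k := by
      by_contra! hcon
      have h2 : Ioc t 1 ∈ 𝓝[>] t := Ioc_mem_nhdsGT ht1
      obtain ⟨t', ht', hm⟩ := ((eventually_all.2 hcon).and h2).exists
      obtain ⟨k, hk⟩ := mem_iUnion.1 (hγm t' ⟨ht0.trans hm.1.le, hm.2⟩)
      exact ht' k hk
    have htk : γ t ∈ S k :=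
      (hS k).mem_of_frequently_of_tendsto hk (hγc.continuousAt.tendsto.mono_left nhdsWithin_le_nhds)
    obtain ⟨t', ht'k, ht'⟩ := (hk.and_eventually (Ioc_mem_nhdsGT hy)).exists
    refine ⟨t', ?_, ht'⟩
    have h3 := (hf k).dist_le_mul _ htk _ ht'k
    have h6 : dist t t' = t' - t := by
      rw [dist_comm, Real.dist_eq, abs_of_pos (sub_pos.2 ht'.1)]
    rw [hγ, dist_lineMap_lineMap, h6] at h3
    have h4 := dist_triangle (f a) (f (γ t)) (f (γ t'))
    have h5 : dist (f a) (f (γ t)) ≤ C * (t * dist a b) := hts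
    change dist (f a) (f (γ t')) ≤ C * (t' * dist a b)
    rw [hγ] at h4 h5 ⊢
    linarith
  have := h1 (right_mem_Icc.2 zero_le_one)
  simpa [s, hγ] using this

/-- A continuous function on the closure of `Ω`, with values in `[0,1]`, and uniformly Lipschitz
in the balls contained in `Ω`. -/
structure IsCutoff (Ω : Set (Euc d)) (σ : Euc d → ℝ) : Prop where
  continuousOn : ContinuousOn σ (closure Ω)
  mem_Icc : ∀ x ∈ Ω, σ x ∈ Icc (0 : ℝ) 1
  lipschitz : ∃ C : NNReal, ∀ x r, Metric.ball x r ⊆ Ω → LipschitzOnWith C σ (Metric.ball x r)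

namespace IsCutoff

variable {Ω : Set (Euc d)} {σ : Euc d → ℝ}

/-- Near the compact support of the test function `σ` is Lipschitz, so it coincides there with a
globally Lipschitz function, for which Rademacher's theorem and integration by parts are available.
-/
theorem hasWeakGrad (h : IsCutoff Ω σ) (hΩ : IsOpen Ω) : HasWeakGrad Ω σ (gradient σ) := by
  intro φ hφ e
  obtain ⟨C, hC⟩ := h.lipschitz
  obtain ⟨δ, hδ, hδΩ⟩ := hφ.2.1.isCompact.exists_cthickening_subset_open hΩ hφ.2.2
  set N := Metric.thickening (δ / 2) (tsupport φ) with hN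
  have hball : ∀ x ∈ N, Metric.ball x (δ / 2) ⊆ Ω := by
    intro x hx y hy
    obtain ⟨z, hz, hxz⟩ := Metric.mem_thickening_iff.1 hx
    refine hδΩ (Metric.thickening_subset_cthickening _ _ (Metric.mem_thickening_iff.2 ⟨z, hz, ?_⟩))
    have := dist_triangle y x z
    rw [Metric.mem_ball] at hy
    linarith
  have hNo : IsOpen N := Metric.isOpen_thickening
  have hφN : tsupport φ ⊆ N := Metric.self_subset_thickening (half_pos hδ) _
  have hNΩ : N ⊆ Ω := fun x hx => hball x hx (Metric.mem_ball_self (half_pos hδ))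
  -- Points at distance below `δ / 2` share a ball contained in `Ω`, where the constant is `C`. For
  -- the others, `σ` varies by at most `1 = (2 / δ) * (δ / 2)`.
  have hlip : LipschitzOnWith (max C (2 / δ).toNNReal) σ N := by
    refine LipschitzOnWith.of_dist_le_mul fun x hx y hy => ?_
    rw [NNReal.coe_max, Real.coe_toNNReal _ (by positivity)]
    rcases lt_or_ge (dist y x) (δ / 2) with hxy | hxy
    · refine ((hC x _ (hball x hx)).dist_le_mul x (Metric.mem_ball_self (half_pos hδ)) y
        hxy).trans ?_
      gcongr
      exact le_max_left _ _
    · have h1 : dist (σ x) (σ y) ≤ 1 := by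
        have hx' := h.mem_Icc x (hNΩ hx)
        have hy' := h.mem_Icc y (hNΩ hy)
        rw [Real.dist_eq, abs_le]
        constructor <;> linarith [hx'.1, hx'.2, hy'.1, hy'.2]
      rw [dist_comm] at hxy
      have h2 : 2 / δ * (δ / 2) = 1 := by field_simp
      calc dist (σ x) (σ y) ≤ 2 / δ * (δ / 2) := h1.trans h2.ge
        _ ≤ max (C : ℝ) (2 / δ) * dist x y := by
          gcongr
          exact le_max_right _ _
  obtain ⟨g, hg, hgσ⟩ := hlip.extend_real
  obtain ⟨D, hD⟩ := hφ.1.lipschitzWith_of_hasCompactSupport hφ.2.1 (by simp)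
  have hibp := hg.integral_lineDeriv_mul_eq (μ := volume) hD hφ.2.1 e
  rw [setIntegral_eq_integral_of_forall_compl_eq_zero fun x hx => by
      simp [hφ.fderiv_eq_zero hx],
    setIntegral_eq_integral_of_forall_compl_eq_zero fun x hx => by simp [hφ.eq_zero hx]]
  have e1 : ∫ x, σ x * fderiv ℝ φ x e = - ∫ x, lineDeriv ℝ φ x (-e) * g x := by
    rw [← integral_neg]
    congr 1
    ext x
    rw [lineDeriv_neg, (hφ.differentiable x).lineDeriv_eq_fderiv]
    by_cases hx : x ∈ tsupport φ
    · rw [hgσ (hφN hx)]; ring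
    · rw [image_eq_zero_of_notMem_tsupport fun h' => hx (tsupport_fderiv_subset ℝ h')]; simp
  rw [e1, ← hibp]
  congr 1
  refine integral_congr_ae ?_
  filter_upwards [hg.ae_differentiableAt (μ := volume)] with x hx
  by_cases hxs : x ∈ tsupport φ
  · have heq : g =ᶠ[𝓝 x] σ := by
      filter_upwards [hNo.mem_nhds (hφN hxs)] with y hy using (hgσ hy).symm
    rw [hx.lineDeriv_eq_fderiv, heq.fderiv_eq, inner_gradient, mul_comm]
  · simp [image_eq_zero_of_notMem_tsupport hxs]

theorem exists_norm_gradient_le (h : IsCutoff Ω σ) (hΩ : IsOpen Ω) :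
    ∃ C : NNReal, ∀ x ∈ Ω, ‖gradient σ x‖ ≤ C := by
  obtain ⟨C, hC⟩ := h.lipschitz
  refine ⟨C, fun x hx => ?_⟩
  obtain ⟨r, hr, hrΩ⟩ := Metric.isOpen_iff.1 hΩ x hx
  simp only [gradient, LinearIsometryEquiv.norm_map]
  exact norm_fderiv_le_of_lipschitzOn ℝ (Metric.ball_mem_nhds x hr) (hC x r hrΩ)

/-- Such a point is an interior minimum, as `σ ≥ 0` in `Ω`. Differentiability is not required,
because `gradient` is `0` where it fails. -/
theorem gradient_eq_zero_of_eq_zero (h : IsCutoff Ω σ) (hΩ : IsOpen Ω) {x : Euc d} (hx : x ∈ Ω)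
    (h0 : σ x = 0) : gradient σ x = 0 := by
  have : IsLocalMin σ x := by
    filter_upwards [hΩ.mem_nhds hx] with y hy
    rw [h0]
    exact (h.mem_Icc y hy).1
  simp [gradient, this.fderiv_eq_zero]

theorem gradient_eq_zero_of_eq_one (h : IsCutoff Ω σ) (hΩ : IsOpen Ω) {x : Euc d} (hx : x ∈ Ω)
    (h1 : σ x = 1) : gradient σ x = 0 := by
  have : IsLocalMax σ x := by
    filter_upwards [hΩ.mem_nhds hx] with y hy
    rw [h1]
    exact (h.mem_Icc y hy).2
  simp [gradient, this.fderiv_eq_zero]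

end IsCutoff

/-! ### Meshes -/

namespace Mesh

variable {Ω : Set (Euc d)} (T : Mesh Ω)

theorem subset_iUnion_closed : Ω ⊆ ⋃ k, (T.K k).closed :=
  T.interior_cover.symm.subset.trans interior_subset

theorem closure_subset_iUnion_closed : closure Ω ⊆ ⋃ k, (T.K k).closed :=
  closure_minimal T.subset_iUnion_closed
    (isClosed_iUnion_of_finite fun k => (T.K k).isClosed_closed)

theorem carrier_subset (k : Fin T.N) : (T.K k).carrier ⊆ Ω :=
  (interior_mono (subset_iUnion (fun k => (T.K k).closed) k)).trans T.interior_cover.subset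

/-- The closed elements cover `Ω`, and passing to their interiors loses finitely many null
boundaries. -/
theorem ae_eq_iUnion_carrier : Ω =ᵐ[volume] ⋃ k, (T.K k).carrier := by
  refine Filter.EventuallyLE.antisymm ?_ (iUnion_subset T.carrier_subset).eventuallyLE
  refine ae_le_set.2 (measure_mono_null (t := ⋃ k, ((T.K k).closed \ (T.K k).carrier)) ?_
    (measure_iUnion_null fun k => (T.K k).volume_closed_diff_carrier))
  rintro x ⟨hx, hx'⟩
  obtain ⟨k, hk⟩ := mem_iUnion.1 (T.subset_iUnion_closed hx)
  exact mem_iUnion.2 ⟨k, hk, fun h => hx' (mem_iUnion.2 ⟨k, h⟩)⟩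

theorem sum_setIntegral {f : Euc d → ℝ} (hf : IntegrableOn f Ω) :
    ∑ k, ∫ x in (T.K k).carrier, f x = ∫ x in Ω, f x := by
  rw [setIntegral_congr_set T.ae_eq_iUnion_carrier, integral_iUnion_fintype
    (fun k => (T.K k).isOpen_carrier.measurableSet) (fun k l hkl => T.disjoint k l hkl)
    fun k => hf.mono_set (T.carrier_subset k)]

/-- On each element the function is a partial sum of a partition of unity, and it is Lipschitz
there. As `Ω` need not be convex, a uniform constant is claimed only on balls inside `Ω`, whose
segments stay covered by elements. The sum of the elementwise constants serves as a common one. -/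
theorem isCutoff_pum {φ : Euc d → Euc d → ℝ} (hφ : T.IsLagrangeBasis φ) (U : Set (Euc d)) :
    IsCutoff Ω (T.pum φ U) := by
  classical
  have heq : ∀ k, ∀ x ∈ (T.K k).closed,
      T.pum φ U x = ∑ s ∈ T.verticesIn U, (T.K k).shape s x := fun k x hx =>
    Finset.sum_congr rfl fun s hs => hφ s (Finset.mem_of_mem_filter s hs) k x hx
  choose C hC using fun k => (T.K k).exists_lipschitzOnWith_sum_shape (T.verticesIn U)
  have hlip : ∀ k, LipschitzOnWith (∑ l, C l) (T.pum φ U) (T.K k).closed := fun k =>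
    (LipschitzOnWith.of_dist_le_mul fun x hx y hy => by
      rw [heq k x hx, heq k y hy]; exact (hC k).dist_le_mul x hx y hy).weaken
      (Finset.single_le_sum (fun _ _ => zero_le) (Finset.mem_univ k))
  refine ⟨?_, ?_, ∑ l, C l, fun x r hxr => ?_⟩
  · exact ((locallyFinite_of_finite fun k => (T.K k).closed).continuousOn_iUnion
      (fun k => (T.K k).isClosed_closed) fun k => (hlip k).continuousOn).mono
      T.closure_subset_iUnion_closed
  · intro x hx
    obtain ⟨k, hk⟩ := mem_iUnion.1 (T.subset_iUnion_closed hx)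
    rw [heq k x hk]
    exact (T.K k).sum_shape_mem_Icc _ hk
  · refine LipschitzOnWith.of_dist_le_mul fun a ha b hb => ?_
    exact dist_le_of_segment_subset (fun k => (T.K k).isClosed_closed) hlip
      ((((convex_ball x r).segment_subset ha hb).trans hxr).trans T.subset_iUnion_closed)

end Mesh

/-! ### The elementwise extension of the quantity of interest. -/

namespace ModelProblem

variable {P : ModelProblem d} (T : Mesh P.Ω) {fQ : Euc d → ℝ} {qQ : Euc d → Euc d}

theorem QH_eq_Q (hfQ : MemLp fQ 2 (volume.restrict P.Ω)) (hqQ : MemLp qQ 2 (volume.restrict P.Ω))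
    {v : Euc d → ℝ} (hv : MemH1 P.Ω v) : P.QH T fQ qQ v = P.Q fQ qQ v := by
  have hi : IntegrableOn (fun x => fQ x * v x + inner ℝ (qQ x) (wgrad P.Ω v x)) P.Ω :=
    (integrable_mul_of_memLp hfQ hv.1).add (integrable_inner_of_memLp hqQ hv.memLp_wgrad)
  rw [Q, ← T.sum_setIntegral hi]
  refine Finset.sum_congr rfl fun k _ => integral_congr_ae ?_
  filter_upwards [hv.wgrad_mono P.isOpen (T.K k).isOpen_carrier (T.carrier_subset k)] with x hx
  simp only [hx]

theorem QH_sub (hfQ : MemLp fQ 2 (volume.restrict P.Ω)) (hqQ : MemLp qQ 2 (volume.restrict P.Ω))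
    {u v : Euc d → ℝ} (hu : T.MemBrokenH1 u) (hv : T.MemBrokenH1 v) :
    P.QH T fQ qQ (u - v) = P.QH T fQ qQ u - P.QH T fQ qQ v := by
  rw [QH, QH, QH, ← Finset.sum_sub_distrib]
  refine Finset.sum_congr rfl fun k _ => ?_
  have hm := Measure.restrict_mono (μ := volume) (T.carrier_subset k) le_rfl
  have hi : ∀ {z : Euc d → ℝ}, T.MemBrokenH1 z → Integrable (fun x => fQ x * z x
      + inner ℝ (qQ x) (wgrad (T.K k).carrier z x)) (volume.restrict (T.K k).carrier) := fun hz =>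
    (integrable_mul_of_memLp (hfQ.mono_measure hm) (hz k).1).add
      (integrable_inner_of_memLp (hqQ.mono_measure hm) (hz k).memLp_wgrad)
  rw [← integral_sub (hi hu) (hi hv)]
  refine integral_congr_ae ?_
  filter_upwards [(hu k).wgrad_sub (T.K k).isOpen_carrier (hv k)] with x hx
  simp only [hx, Pi.sub_apply, inner_sub_right]
  ring

theorem MemV.memBrokenH1 {u : Euc d → ℝ} (h : P.MemV u) : T.MemBrokenH1 u := fun k =>
  h.memH1.mono P.isOpen (T.carrier_subset k)

end ModelProblem

/-! ### Functions of `H^1_0` and their products with a cutoff -/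

section Vanish

variable {U W : Set (Euc d)} {E : Type*} [NormedAddCommGroup E] {f : Euc d → E}

theorem eLpNorm_restrict_of_vanish (hU : MeasurableSet U) (hUW : U ⊆ W)
    (h : ∀ x, x ∉ U → f x = 0) (p : ℝ≥0∞) :
    eLpNorm f p (volume.restrict W) = eLpNorm f p (volume.restrict U) := by
  have : U.indicator f = f := indicator_eq_self.2 fun x hx => by
    by_contra hxU
    exact hx (h x hxU)
  nth_rewrite 1 [← this]
  rw [eLpNorm_indicator_eq_eLpNorm_restrict hU, Measure.restrict_restrict hU,
    inter_eq_self_of_subset_left hUW]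

theorem memLp_restrict_of_vanish (hU : MeasurableSet U) (hUW : U ⊆ W)
    (h : ∀ x, x ∉ U → f x = 0) {p : ℝ≥0∞} (hf : MemLp f p (volume.restrict U)) :
    MemLp f p (volume.restrict W) := by
  have : U.indicator f = f := indicator_eq_self.2 fun x hx => by
    by_contra hxU
    exact hx (h x hxU)
  rw [← this, memLp_indicator_iff_restrict hU, Measure.restrict_restrict hU,
    inter_eq_self_of_subset_left hUW]
  exact hf

end Vanish

theorem tendsto_eLpNorm_smul {X E : Type*} [MeasurableSpace X] {μ : Measure X}
    [NormedAddCommGroup E] [NormedSpace ℝ E] {b : X → ℝ} {f : ℕ → X → E} (hb : MemLp b ∞ μ)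
    (mf : ∀ n, AEStronglyMeasurable (f n) μ)
    (hf : Tendsto (fun n => eLpNorm (f n) 2 μ) atTop (𝓝 0)) :
    Tendsto (fun n => eLpNorm (b • f n) 2 μ) atTop (𝓝 0) := by
  have h0 : Tendsto (fun n => eLpNorm b ∞ μ * eLpNorm (f n) 2 μ) atTop (𝓝 0) := by
    simpa using ENNReal.Tendsto.const_mul hf (Or.inr hb.2.ne)
  exact tendsto_of_tendsto_of_tendsto_of_le_of_le tendsto_const_nhds h0 (fun _ => zero_le)
    fun n => eLpNorm_smul_le_mul_eLpNorm (mf n) hb.1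

theorem tendsto_eLpNorm_smul' {X E : Type*} [MeasurableSpace X] {μ : Measure X}
    [NormedAddCommGroup E] [NormedSpace ℝ E] {b : ℕ → X → ℝ} {f : X → E} (hf : MemLp f ∞ μ)
    (mb : ∀ n, AEStronglyMeasurable (b n) μ)
    (hb : Tendsto (fun n => eLpNorm (b n) 2 μ) atTop (𝓝 0)) :
    Tendsto (fun n => eLpNorm (b n • f) 2 μ) atTop (𝓝 0) := by
  have h0 : Tendsto (fun n => eLpNorm (b n) 2 μ * eLpNorm f ∞ μ) atTop (𝓝 0) := by
    simpa using ENNReal.Tendsto.mul_const hb (Or.inr hf.2.ne)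
  exact tendsto_of_tendsto_of_tendsto_of_le_of_le tendsto_const_nhds h0 (fun _ => zero_le)
    fun n => eLpNorm_smul_le_mul_eLpNorm hf.1 (mb n)

section Enrichment

variable {U Ω : Set (Euc d)} {u σ : Euc d → ℝ}

/-- Extension by zero from `U` to `Ω`, without any regularity of `∂U`: it is harmless for test
functions, and the limit has as weak gradient the gradient on `U` extended by zero. -/
theorem MemH10.exists_approx (h : MemH10 U u) (hU : IsOpen U) (hΩ : IsOpen Ω) (hUΩ : U ⊆ Ω) :
    MemH1 Ω u ∧ ∃ ψ : ℕ → Euc d → ℝ, (∀ n, IsTest U (ψ n)) ∧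
      Tendsto (fun n => eLpNorm (ψ n - u) 2 (volume.restrict Ω)) atTop (𝓝 0) ∧
      Tendsto (fun n => eLpNorm (gradient (ψ n) - wgrad Ω u) 2 (volume.restrict Ω)) atTop
        (𝓝 0) := by
  obtain ⟨h0, h1, ψ, hψ, hψ0, hψ1⟩ := h
  have hUm := hU.measurableSet
  set G := U.indicator (wgrad U u) with hG
  have hG0 : ∀ x, x ∉ U → G x = 0 := fun x hx => indicator_of_notMem hx _
  have hGU : G =ᵐ[volume.restrict U] wgrad U u := indicator_ae_eq_restrict hUm
  have mu : MemLp u 2 (volume.restrict Ω) := memLp_restrict_of_vanish hUm hUΩ h0 h1.1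
  have mG : MemLp G 2 (volume.restrict Ω) := memLp_restrict_of_vanish hUm hUΩ hG0
    ((memLp_congr_ae hGU).2 h1.memLp_wgrad)
  have t0 : Tendsto (fun n => eLpNorm (ψ n - u) 2 (volume.restrict Ω)) atTop (𝓝 0) := by
    refine hψ0.congr fun n => (eLpNorm_restrict_of_vanish hUm hUΩ (fun x hx => ?_) 2).symm
    simp [(hψ n).eq_zero hx, h0 x hx]
  have t1 : Tendsto (fun n => eLpNorm (gradient (ψ n) - G) 2 (volume.restrict Ω)) atTop
      (𝓝 0) := by
    refine hψ1.congr fun n => ?_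
    rw [eLpNorm_restrict_of_vanish hUm hUΩ (f := gradient (ψ n) - G) (fun x hx => by
      simp [(hψ n).gradient_eq_zero hx, hG0 x hx]) 2]
    exact eLpNorm_congr_ae (((hψ n).wgrad_ae_eq hU).sub hGU.symm)
  have hw : HasWeakGrad Ω u G := HasWeakGrad.of_tendsto (fun n => (hψ n).hasWeakGrad Ω)
    (fun n => (hψ n).memLp Ω 2) (fun n => (hψ n).memLp_gradient Ω 2) mu mG t0 t1
  refine ⟨hw.memH1 mu mG, ψ, hψ, t0, t1.congr fun n => eLpNorm_congr_ae ?_⟩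
  exact (EventuallyEq.rfl).sub (hw.wgrad_ae_eq hΩ mu mG).symm

namespace IsCutoff

theorem memLp_top (h : IsCutoff Ω σ) (hΩ : IsOpen Ω) : MemLp σ ∞ (volume.restrict Ω) := by
  refine memLp_top_of_bound ((h.continuousOn.mono subset_closure).aestronglyMeasurable
    hΩ.measurableSet) 1
    ((ae_restrict_iff' hΩ.measurableSet).2 (Eventually.of_forall fun x hx => ?_))
  rw [Real.norm_eq_abs, abs_of_nonneg (h.mem_Icc x hx).1]
  exact (h.mem_Icc x hx).2

theorem memLp_top_gradient (h : IsCutoff Ω σ) (hΩ : IsOpen Ω) :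
    MemLp (gradient σ) ∞ (volume.restrict Ω) := by
  obtain ⟨C, hC⟩ := h.exists_norm_gradient_le hΩ
  exact memLp_top_of_bound (measurable_gradient σ).aestronglyMeasurable C
    ((ae_restrict_iff' hΩ.measurableSet).2 (Eventually.of_forall hC))

/-- The product rule comes from testing the weak gradient of `σ` against `ψ θ`, which is again a
test function. -/
theorem hasWeakGrad_test_mul (h : IsCutoff Ω σ) (hΩ : IsOpen Ω) {ψ : Euc d → ℝ}
    (hψ : IsTest Ω ψ) :
    HasWeakGrad Ω (ψ * σ) (σ • gradient ψ + ψ • gradient σ) := by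
  intro θ hθ e
  have key := h.hasWeakGrad hΩ _ (hψ.mul hθ) e
  have d1 : ∀ x, fderiv ℝ (fun x => ψ x * θ x) x e
      = ψ x * fderiv ℝ θ x e + θ x * fderiv ℝ ψ x e := fun x => by
    rw [fderiv_fun_mul (hψ.differentiable x) (hθ.differentiable x)]
    simp
  have mψθ : MemLp (fun x => ψ x * fderiv ℝ θ x e) 1 (volume.restrict Ω) :=
    memLp_one_iff_integrable.2 (integrable_mul_of_memLp (hψ.memLp Ω 2) (hθ.memLp_fderiv Ω 2 e))
  have mθψ : MemLp (fun x => θ x * fderiv ℝ ψ x e) 1 (volume.restrict Ω) :=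
    memLp_one_iff_integrable.2 (integrable_mul_of_memLp (hθ.memLp Ω 2) (hψ.memLp_fderiv Ω 2 e))
  have i1 : Integrable (fun x => σ x * (ψ x * fderiv ℝ θ x e)) (volume.restrict Ω) :=
    (h.memLp_top hΩ).integrable_mul mψθ
  have i2 : Integrable (fun x => σ x * (θ x * fderiv ℝ ψ x e)) (volume.restrict Ω) :=
    (h.memLp_top hΩ).integrable_mul mθψ
  have i3 : Integrable (fun x => inner ℝ (gradient σ x) e * (ψ x * θ x)) (volume.restrict Ω) :=
    (memLp_inner_const (h.memLp_top_gradient hΩ) e).integrable_mul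
      ((hψ.mul hθ).memLp Ω 1)
  simp_rw [d1, mul_add] at key
  rw [integral_add i1 i2] at key
  have e1 : ∀ x, (ψ * σ) x * fderiv ℝ θ x e = σ x * (ψ x * fderiv ℝ θ x e) := fun x => by
    simp; ring
  have e2 : ∀ x, θ x * inner ℝ ((σ • gradient ψ + ψ • gradient σ) x) e
      = σ x * (θ x * fderiv ℝ ψ x e) + inner ℝ (gradient σ x) e * (ψ x * θ x) := fun x => by
    simp only [Pi.add_apply, Pi.smul_apply', inner_add_left, inner_smul_left, inner_gradient]
    simp
    ring
  simp_rw [e1, e2]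
  rw [integral_add i2 i3]
  have e3 : ∀ x, inner ℝ (gradient σ x) e * (ψ x * θ x) = ψ x * θ x * inner ℝ (gradient σ x) e :=
    fun x => mul_comm _ _
  simp_rw [e3]
  linarith

theorem memLp_mul (h : IsCutoff Ω σ) (hΩ : IsOpen Ω) {v : Euc d → ℝ}
    (hv : MemLp v 2 (volume.restrict Ω)) : MemLp (v * σ) 2 (volume.restrict Ω) := by
  rw [mul_comm]
  exact MemLp.smul (p := ∞) (q := 2) (r := 2) hv (h.memLp_top hΩ)

theorem memLp_mul_grad (h : IsCutoff Ω σ) (hΩ : IsOpen Ω) {v : Euc d → ℝ} {G : Euc d → Euc d}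
    (hv : MemLp v 2 (volume.restrict Ω)) (hG : MemLp G 2 (volume.restrict Ω)) :
    MemLp (σ • G + v • gradient σ) 2 (volume.restrict Ω) :=
  (MemLp.smul (p := ∞) (q := 2) (r := 2) hG (h.memLp_top hΩ)).add
    (MemLp.smul (p := 2) (q := ∞) (r := 2) (h.memLp_top_gradient hΩ) hv)

end IsCutoff

section Product

variable (h : MemH10 U u) (hU : IsOpen U) (hΩ : IsOpen Ω) (hUΩ : U ⊆ Ω) (hσ : IsCutoff Ω σ)

include h hU hΩ hUΩ hσ

theorem MemH10.exists_approx_mul : ∃ ψ : ℕ → Euc d → ℝ, (∀ n, IsTest U (ψ n)) ∧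
      Tendsto (fun n => eLpNorm (ψ n * σ - u * σ) 2 (volume.restrict Ω)) atTop (𝓝 0) ∧
      Tendsto (fun n => eLpNorm (σ • gradient (ψ n) + ψ n • gradient σ
        - (σ • wgrad Ω u + u • gradient σ)) 2 (volume.restrict Ω)) atTop (𝓝 0) := by
  obtain ⟨hu, ψ, hψ, t0, t1⟩ := h.exists_approx hU hΩ hUΩ
  have m0 : ∀ n, AEStronglyMeasurable (ψ n - u) (volume.restrict Ω) := fun n =>
    (((hψ n).memLp Ω 2).sub hu.1).1
  have m1 : ∀ n, AEStronglyMeasurable (gradient (ψ n) - wgrad Ω u) (volume.restrict Ω) :=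
    fun n => (((hψ n).memLp_gradient Ω 2).sub hu.memLp_wgrad).1
  have s0 := tendsto_eLpNorm_smul (hσ.memLp_top hΩ) m0 t0
  have s1 := tendsto_eLpNorm_smul (hσ.memLp_top hΩ) m1 t1
  have s2 := tendsto_eLpNorm_smul' (hσ.memLp_top_gradient hΩ) m0 t0
  have s3 := tendsto_eLpNorm_add_smul (fun n => (hσ.memLp_top hΩ).1.smul (m1 n))
    (fun n => (m0 n).smul (hσ.memLp_top_gradient hΩ).1) 1 s1 s2
  refine ⟨ψ, hψ, s0.congr fun n => ?_, s3.congr fun n => ?_⟩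
  · congr 1
    ext x
    simp
    ring
  · congr 1
    funext x
    simp only [Pi.add_apply, Pi.sub_apply, Pi.smul_apply', one_smul]
    module

theorem MemH10.hasWeakGrad_mul : HasWeakGrad Ω (u * σ) (σ • wgrad Ω u + u • gradient σ) := by
  obtain ⟨hu, -⟩ := h.exists_approx hU hΩ hUΩ
  obtain ⟨ψ, hψ, t0, t1⟩ := h.exists_approx_mul hU hΩ hUΩ hσ
  exact HasWeakGrad.of_tendsto (fun n => hσ.hasWeakGrad_test_mul hΩ ((hψ n).mono hUΩ))
    (fun n => hσ.memLp_mul hΩ ((hψ n).memLp Ω 2))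
    (fun n => hσ.memLp_mul_grad hΩ ((hψ n).memLp Ω 2) ((hψ n).memLp_gradient Ω 2))
    (hσ.memLp_mul hΩ hu.1) (hσ.memLp_mul_grad hΩ hu.1 hu.memLp_wgrad) t0 t1

theorem MemH10.memH1_mul : MemH1 Ω (u * σ) := by
  obtain ⟨hu, -⟩ := h.exists_approx hU hΩ hUΩ
  exact (h.hasWeakGrad_mul hU hΩ hUΩ hσ).memH1 (hσ.memLp_mul hΩ hu.1)
    (hσ.memLp_mul_grad hΩ hu.1 hu.memLp_wgrad)

theorem MemH10.wgrad_mul_ae_eq :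
    wgrad Ω (u * σ) =ᵐ[volume.restrict Ω] σ • wgrad Ω u + u • gradient σ := by
  obtain ⟨hu, -⟩ := h.exists_approx hU hΩ hUΩ
  exact (h.hasWeakGrad_mul hU hΩ hUΩ hσ).wgrad_ae_eq hΩ (hσ.memLp_mul hΩ hu.1)
    (hσ.memLp_mul_grad hΩ hu.1 hu.memLp_wgrad)

/-- The approximants `ψ n * σ` are continuous on `closure Ω` and vanish identically on `∂Ω`, since
`∂Ω` is disjoint from `Ω ⊇ U`. This holds even when `closure U` touches `∂Ω`. -/
theorem MemH10.hasTrace_mul : HasTrace Ω (u * σ) 0 := by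
  obtain ⟨ψ, hψ, t0, t1⟩ := h.exists_approx_mul hU hΩ hUΩ hσ
  have hw : ∀ n, HasWeakGrad Ω (ψ n * σ) (σ • gradient (ψ n) + ψ n • gradient σ) := fun n =>
    hσ.hasWeakGrad_test_mul hΩ ((hψ n).mono hUΩ)
  have m0 : ∀ n, MemLp (ψ n * σ) 2 (volume.restrict Ω) := fun n =>
    hσ.memLp_mul hΩ ((hψ n).memLp Ω 2)
  have m1 : ∀ n, MemLp (σ • gradient (ψ n) + ψ n • gradient σ) 2 (volume.restrict Ω) := fun n =>
    hσ.memLp_mul_grad hΩ ((hψ n).memLp Ω 2) ((hψ n).memLp_gradient Ω 2)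
  refine ⟨h.memH1_mul hU hΩ hUΩ hσ, MemLp.zero', fun n => ψ n * σ, fun n =>
    ⟨(hψ n).1.continuous.continuousOn.mul hσ.continuousOn, (hw n).memH1 (m0 n) (m1 n)⟩,
    ⟨t0, t1.congr fun n => eLpNorm_congr_ae ?_⟩, ?_⟩
  · exact ((hw n).wgrad_ae_eq hΩ (m0 n) (m1 n)).symm.sub (h.wgrad_mul_ae_eq hU hΩ hUΩ hσ).symm
  · have : ∀ n, eLpNorm (ψ n * σ - 0) 2 ((surf d).restrict (frontier Ω)) = 0 := fun n => by
      refine (eLpNorm_congr_ae ?_).trans eLpNorm_zero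
      refine (ae_restrict_iff' isClosed_frontier.measurableSet).2
        (Eventually.of_forall fun x hx => ?_)
      have hxΩ : x ∉ Ω := by
        rw [hΩ.frontier_eq] at hx
        exact hx.2
      simp [(hψ n).eq_zero fun hxU => hxΩ (hUΩ hxU)]
    simp_rw [this]
    exact tendsto_const_nhds

end Product

theorem ModelProblem.memVWith_of_isTest {P : ModelProblem d} {φ : Euc d → ℝ}
    (h : IsTest P.Ω φ) : P.MemVWith φ 0 := by
  have h1 : IsCutoff P.Ω (1 : Euc d → ℝ) :=
    ⟨continuousOn_const, fun _ _ => ⟨zero_le_one, le_rfl⟩, 0,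
      fun _ _ _ => LipschitzOnWith.of_dist_le_mul fun _ _ _ _ => by simp⟩
  have := h.memH10.hasTrace_mul P.isOpen P.isOpen le_rfl h1
  rw [mul_one] at this
  exact ⟨this, Eventually.of_forall fun _ => rfl⟩

end Enrichment

/-! ### Elliptic matrices -/

/-- `M` is symmetric and `α|ξ|² ≤ Mξ·ξ ≤ β|ξ|²`. -/
structure IsElliptic (α β : ℝ) (M : Matrix (Fin d) (Fin d) ℝ) : Prop where
  symm : M.IsSymm
  bounds : ∀ ξ : Euc d, α * ‖ξ‖ ^ 2 ≤ inner ℝ (act M ξ) ξ ∧ inner ℝ (act M ξ) ξ ≤ β * ‖ξ‖ ^ 2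

theorem act_apply (M : Matrix (Fin d) (Fin d) ℝ) (ξ : Euc d) (i : Fin d) :
    act M ξ i = ∑ j, M i j * ξ j := rfl

theorem act_mul (M N : Matrix (Fin d) (Fin d) ℝ) (ξ : Euc d) :
    act (M * N) ξ = act M (act N ξ) := by
  simp [act, Matrix.toLpLin_apply, Matrix.mulVec_mulVec]

theorem act_one (ξ : Euc d) : act (1 : Matrix (Fin d) (Fin d) ℝ) ξ = ξ := by
  simp [act]

theorem act_add (M : Matrix (Fin d) (Fin d) ℝ) (ξ η : Euc d) :
    act M (ξ + η) = act M ξ + act M η := map_add _ _ _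

theorem act_sub (M : Matrix (Fin d) (Fin d) ℝ) (ξ η : Euc d) :
    act M (ξ - η) = act M ξ - act M η := map_sub _ _ _

theorem act_smul (M : Matrix (Fin d) (Fin d) ℝ) (c : ℝ) (ξ : Euc d) :
    act M (c • ξ) = c • act M ξ := map_smul _ _ _

theorem inner_act_comm {M : Matrix (Fin d) (Fin d) ℝ} (hM : M.IsSymm) (ξ η : Euc d) :
    (inner ℝ (act M ξ) η : ℝ) = inner ℝ (act M η) ξ := by
  simp only [PiLp.inner_apply, act_apply, RCLike.inner_apply, conj_trivial, Finset.mul_sum]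
  rw [Finset.sum_comm]
  refine Finset.sum_congr rfl fun i _ => Finset.sum_congr rfl fun j _ => ?_
  rw [hM.apply i j]
  ring

namespace IsElliptic

variable {α β : ℝ} {M : Matrix (Fin d) (Fin d) ℝ}

/-- Ellipticity bounds only the quadratic form; symmetry upgrades this to an operator norm bound,
which keeps fluxes in `L^2`. -/
theorem norm_act_le (h : IsElliptic α β M) (hα : 0 < α) (ξ : Euc d) :
    ‖act M ξ‖ ≤ β * ‖ξ‖ := by
  set η := act M ξ with hη
  rcases eq_or_ne η 0 with h0 | h0
  · rcases eq_or_ne ξ 0 with h1 | h1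
    · simp [h0, h1]
    · have hp : 0 < ‖ξ‖ ^ 2 := by positivity
      have := h.bounds ξ
      rw [← hη, h0, inner_zero_left] at this
      nlinarith [this.1, mul_pos hα hp]
  · -- polarization with the vectors `s ξ ± r η`, `s = |η|`, `r = |ξ|`
    have hs : 0 < ‖η‖ := norm_pos_iff.2 h0
    have hξ : ξ ≠ 0 := fun h1 => h0 (by rw [hη, h1]; exact map_zero _)
    have hr : 0 < ‖ξ‖ := norm_pos_iff.2 hξ
    have hp := (h.bounds (‖η‖ • ξ + ‖ξ‖ • η)).2
    have hm := (h.bounds (‖η‖ • ξ - ‖ξ‖ • η)).1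
    have hm' : 0 ≤ (inner ℝ (act M (‖η‖ • ξ - ‖ξ‖ • η)) (‖η‖ • ξ - ‖ξ‖ • η) : ℝ) :=
      le_trans (by positivity) hm
    have hβ : 0 ≤ β := by
      have h1 := h.bounds ξ
      have h2 : 0 < ‖ξ‖ ^ 2 := by positivity
      nlinarith [h1.1, h1.2, mul_pos hα h2]
    have hn : ‖‖η‖ • ξ + ‖ξ‖ • η‖ ≤ 2 * (‖η‖ * ‖ξ‖) := by
      refine (norm_add_le _ _).trans (le_of_eq ?_)
      simp [norm_smul]
      ring
    have hn2 : ‖‖η‖ • ξ + ‖ξ‖ • η‖ ^ 2 ≤ (2 * (‖η‖ * ‖ξ‖)) ^ 2 := by gcongr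
    have hsy := inner_act_comm h.symm η ξ
    have e : (inner ℝ (act M (‖η‖ • ξ + ‖ξ‖ • η)) (‖η‖ • ξ + ‖ξ‖ • η) : ℝ)
        - inner ℝ (act M (‖η‖ • ξ - ‖ξ‖ • η)) (‖η‖ • ξ - ‖ξ‖ • η)
        = 4 * (‖η‖ * ‖ξ‖ * ‖η‖ ^ 2) := by
      simp only [act_add, act_sub, act_smul, inner_add_left, inner_add_right, inner_sub_left,
        inner_sub_right, inner_smul_left, inner_smul_right, conj_trivial, hsy]
      rw [← hη, real_inner_self_eq_norm_sq]
      ring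
    have h4 : 4 * (‖η‖ * ‖ξ‖ * ‖η‖ ^ 2) ≤ β * (2 * (‖η‖ * ‖ξ‖)) ^ 2 := by
      have := mul_le_mul_of_nonneg_left hn2 hβ
      linarith
    have h5 : (4 * ‖η‖ ^ 2 * ‖ξ‖) * ‖η‖ ≤ (4 * ‖η‖ ^ 2 * ‖ξ‖) * (β * ‖ξ‖) := by
      linarith
    exact le_of_mul_le_mul_left h5 (by positivity)

theorem isUnit_det (h : IsElliptic α β M) (hα : 0 < α) : IsUnit M.det := by
  rw [← Matrix.isUnit_iff_isUnit_det, ← Matrix.mulVec_injective_iff_isUnit]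
  refine (injective_iff_map_eq_zero (Matrix.mulVecLin M)).2 fun x hx => ?_
  have h1 := (h.bounds (WithLp.toLp 2 x)).1
  have h2 : act M (WithLp.toLp 2 x) = 0 := by
    have : M.mulVec x = 0 := hx
    simp [act, Matrix.toLpLin_apply, this]
  rw [h2, inner_zero_left] at h1
  have h3 : ‖(WithLp.toLp 2 x : Euc d)‖ = 0 := by
    by_contra hne
    have : 0 < ‖(WithLp.toLp 2 x : Euc d)‖ ^ 2 := by positivity
    nlinarith [mul_pos hα this]
  have h4 := norm_eq_zero.1 h3
  ext i
  exact congrFun (congrArg WithLp.ofLp h4) i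

theorem act_inv_act (h : IsElliptic α β M) (hα : 0 < α) (ξ : Euc d) :
    act M⁻¹ (act M ξ) = ξ := by
  rw [← act_mul, Matrix.nonsing_inv_mul M (h.isUnit_det hα), act_one]

theorem act_act_inv (h : IsElliptic α β M) (hα : 0 < α) (ξ : Euc d) :
    act M (act M⁻¹ ξ) = ξ := by
  rw [← act_mul, Matrix.mul_nonsing_inv M (h.isUnit_det hα), act_one]

theorem inner_act_inv_comm (h : IsElliptic α β M) (ξ η : Euc d) :
    (inner ℝ (act M⁻¹ ξ) η : ℝ) = inner ℝ (act M⁻¹ η) ξ :=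
  inner_act_comm (by rw [Matrix.IsSymm, Matrix.transpose_nonsing_inv, h.symm.eq]) ξ η

theorem inner_act_inv_nonneg (h : IsElliptic α β M) (hα : 0 < α) (ξ : Euc d) :
    0 ≤ (inner ℝ (act M⁻¹ ξ) ξ : ℝ) := by
  nth_rewrite 2 [← h.act_act_inv hα ξ]
  rw [real_inner_comm]
  exact le_trans (by positivity) (h.bounds (act M⁻¹ ξ)).1

theorem norm_act_inv_le (h : IsElliptic α β M) (hα : 0 < α) (ξ : Euc d) :
    ‖act M⁻¹ ξ‖ ≤ α⁻¹ * ‖ξ‖ := by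
  have h1 := (h.bounds (act M⁻¹ ξ)).1
  rw [h.act_act_inv hα] at h1
  have h2 := real_inner_le_norm ξ (act M⁻¹ ξ)
  rcases eq_or_ne ‖act M⁻¹ ξ‖ 0 with h0 | h0
  · rw [h0]; positivity
  · have hp : 0 < ‖act M⁻¹ ξ‖ := lt_of_le_of_ne (norm_nonneg _) h0.symm
    rw [inv_mul_eq_div, le_div_iff₀ hα]
    refine le_of_mul_le_mul_right (?_ : _ * ‖act M⁻¹ ξ‖ ≤ _ * ‖act M⁻¹ ξ‖) hp
    linarith

end IsElliptic

/-! ### Fields of elliptic matrices -/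

theorem aestronglyMeasurable_of_forall_apply {X ι E : Type*} [Finite ι] [MeasurableSpace X]
    [TopologicalSpace E] [TopologicalSpace.PseudoMetrizableSpace E] [SecondCountableTopology E]
    [MeasurableSpace E] [BorelSpace E] {μ : Measure X} {f : X → ι → E}
    (hf : ∀ i, AEStronglyMeasurable (fun x => f x i) μ) : AEStronglyMeasurable f μ := by
  have := Fintype.ofFinite ι
  refine ⟨fun x i => (hf i).mk _ x, Measurable.stronglyMeasurable
    (measurable_pi_iff.2 fun i => (hf i).stronglyMeasurable_mk.measurable), ?_⟩
  filter_upwards [eventually_all.2 fun i => (hf i).ae_eq_mk] with x hx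
  exact funext hx

theorem aestronglyMeasurable_act {μ : Measure (Euc d)} {A : Euc d → Matrix (Fin d) (Fin d) ℝ}
    (hA : ∀ i j, AEStronglyMeasurable (fun x => A x i j) μ) {F : Euc d → Euc d}
    (hF : AEStronglyMeasurable F μ) : AEStronglyMeasurable (fun x => act (A x) (F x)) μ := by
  have h : AEStronglyMeasurable (fun x (i : Fin d) => ∑ j, A x i j * F x j) μ := by
    refine aestronglyMeasurable_of_forall_apply fun i => ?_
    refine Finset.aestronglyMeasurable_fun_sum _ fun j _ => (hA i j).mul ?_
    exact (EuclideanSpace.proj (𝕜 := ℝ) j).continuous.comp_aestronglyMeasurable hF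
  exact (PiLp.continuous_toLp 2 _).comp_aestronglyMeasurable h

/-- Cramer's formula: the entries are those of the adjugate, polynomial in `A`, times the inverse
determinant, with `0⁻¹ = 0` at singular matrices. -/
theorem aestronglyMeasurable_inv {μ : Measure (Euc d)} {A : Euc d → Matrix (Fin d) (Fin d) ℝ}
    (hA : ∀ i j, AEStronglyMeasurable (fun x => A x i j) μ) (i j : Fin d) :
    AEStronglyMeasurable (fun x => (A x)⁻¹ i j) μ := by
  have h : AEStronglyMeasurable (fun x (i j : Fin d) => A x i j) μ :=
    aestronglyMeasurable_of_forall_apply fun i =>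
      aestronglyMeasurable_of_forall_apply fun j => hA i j
  have hdet : AEStronglyMeasurable (fun x => (A x).det) μ :=
    (continuous_id.matrix_det (n := Fin d) (R := ℝ)).comp_aestronglyMeasurable h
  have hadj : AEStronglyMeasurable (fun x => (A x).adjugate i j) μ :=
    have hc := (continuous_id.matrix_adjugate (n := Fin d) (R := ℝ)).matrix_elem i j
    hc.comp_aestronglyMeasurable h
  simp only [Matrix.inv_def, Ring.inverse_eq_inv', Matrix.smul_apply, smul_eq_mul]
  exact hdet.aemeasurable.inv.aestronglyMeasurable.mul hadj

/-! ### The inner product weighted by `A⁻¹` on square integrable fields. -/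

namespace ModelProblem

variable (P : ModelProblem d)

theorem exists_isElliptic : ∃ α β : ℝ, 0 < α ∧
    ∀ᵐ x ∂(volume.restrict P.Ω), IsElliptic α β (P.A x) := by
  obtain ⟨α, β, hα, -, h⟩ := P.A_elliptic
  refine ⟨α, β, hα, ?_⟩
  filter_upwards [P.A_symm, h] with x h1 h2 using ⟨h1, h2⟩

variable {P} {F G : Euc d → Euc d}

theorem memLp_act (hF : MemLp F 2 (volume.restrict P.Ω)) :
    MemLp (fun x => act (P.A x) (F x)) 2 (volume.restrict P.Ω) := by
  obtain ⟨α, β, hα, h⟩ := P.exists_isElliptic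
  exact hF.of_le_mul (aestronglyMeasurable_act P.A_measurable hF.1)
    (h.mono fun x hx => hx.norm_act_le hα _)

theorem memLp_act_inv (hF : MemLp F 2 (volume.restrict P.Ω)) :
    MemLp (fun x => act (P.A x)⁻¹ (F x)) 2 (volume.restrict P.Ω) := by
  obtain ⟨α, β, hα, h⟩ := P.exists_isElliptic
  exact hF.of_le_mul (aestronglyMeasurable_act (aestronglyMeasurable_inv P.A_measurable) hF.1)
    (h.mono fun x hx => hx.norm_act_inv_le hα _)

theorem memLp_flux {u : Euc d → ℝ} (hu : MemH1 P.Ω u) :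
    MemLp (P.flux u) 2 (volume.restrict P.Ω) := memLp_act hu.memLp_wgrad

variable (P) in
/-- The inner product `∫_Ω A⁻¹ F · G`. -/
noncomputable def invInner (F G : Euc d → Euc d) : ℝ :=
  ∫ x in P.Ω, inner ℝ (act (P.A x)⁻¹ (F x)) (G x)

theorem integrable_invInner (hF : MemLp F 2 (volume.restrict P.Ω))
    (hG : MemLp G 2 (volume.restrict P.Ω)) :
    Integrable (fun x => (inner ℝ (act (P.A x)⁻¹ (F x)) (G x) : ℝ)) (volume.restrict P.Ω) :=
  integrable_inner_of_memLp (memLp_act_inv hF) hG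

theorem invInner_comm (F G : Euc d → Euc d) : P.invInner F G = P.invInner G F := by
  obtain ⟨α, β, hα, h⟩ := P.exists_isElliptic
  exact integral_congr_ae (h.mono fun x hx => hx.inner_act_inv_comm _ _)

theorem invInner_self_nonneg (F : Euc d → Euc d) : 0 ≤ P.invInner F F := by
  obtain ⟨α, β, hα, h⟩ := P.exists_isElliptic
  exact integral_nonneg_of_ae (h.mono fun x hx => hx.inner_act_inv_nonneg hα _)

theorem invInner_add_smul_right {H : Euc d → Euc d} (hF : MemLp F 2 (volume.restrict P.Ω))
    (hG : MemLp G 2 (volume.restrict P.Ω)) (hH : MemLp H 2 (volume.restrict P.Ω)) (c : ℝ) :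
    P.invInner F (G + c • H) = P.invInner F G + c * P.invInner F H := by
  unfold invInner
  rw [← integral_const_mul, ← integral_add (integrable_invInner hF hG)
    ((integrable_invInner hF hH).const_mul c)]
  congr 1
  ext x
  simp [inner_add_right, inner_smul_right]

theorem invInner_add_smul_self (hF : MemLp F 2 (volume.restrict P.Ω))
    (hG : MemLp G 2 (volume.restrict P.Ω)) (c : ℝ) :
    P.invInner (F + c • G) (F + c • G)
      = P.invInner F F + 2 * c * P.invInner F G + c ^ 2 * P.invInner G G := by
  rw [invInner_add_smul_right (hF.add (hG.const_smul c)) hF hG, invInner_comm _ F,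
    invInner_comm _ G, invInner_add_smul_right hF hF hG, invInner_add_smul_right hG hF hG,
    invInner_comm G F]
  ring

/-- Cauchy–Schwarz, from the nonpositive discriminant of the nonnegative quadratic `c ↦ ⟨F + c G, F
+ c G⟩`. -/
theorem abs_invInner_le (hF : MemLp F 2 (volume.restrict P.Ω))
    (hG : MemLp G 2 (volume.restrict P.Ω)) :
    |P.invInner F G| ≤ Real.sqrt (P.invInner F F) * Real.sqrt (P.invInner G G) := by
  have h : discrim (P.invInner G G) (2 * P.invInner F G) (P.invInner F F) ≤ 0 :=
    discrim_le_zero fun c => by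
      have := invInner_self_nonneg (P := P) (F + c • G)
      rw [invInner_add_smul_self hF hG] at this
      linarith
  rw [discrim] at h
  rw [← Real.sqrt_mul (invInner_self_nonneg F)]
  exact Real.abs_le_sqrt (by linarith)

/-- With `G = ∇v`, this translates weak formulations `∫ p·∇v` into inner products of `p` with the
flux `A∇v`. -/
theorem invInner_act (F : Euc d → Euc d) (G : Euc d → Euc d) :
    P.invInner F (fun x => act (P.A x) (G x)) = ∫ x in P.Ω, inner ℝ (F x) (G x) := by
  obtain ⟨α, β, hα, h⟩ := P.exists_isElliptic
  refine integral_congr_ae (h.mono fun x hx => ?_)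
  simp only
  rw [hx.inner_act_inv_comm, hx.act_inv_act hα, real_inner_comm]

theorem ECRE_eq (u : Euc d → ℝ) (p : Euc d → Euc d) :
    P.ECRE u p = Real.sqrt (P.invInner (p - P.flux u) (p - P.flux u)) := rfl

end ModelProblem

namespace ModelProblem

variable {P : ModelProblem d} {fQ : Euc d → ℝ} {qQ : Euc d → Euc d} {u v w : Euc d → ℝ}

theorem flux_add_smul (hu : MemH1 P.Ω u) (hv : MemH1 P.Ω v) (c : ℝ) :
    P.flux (u + c • v) =ᵐ[volume.restrict P.Ω] P.flux u + c • P.flux v := by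
  filter_upwards [hu.wgrad_add_smul P.isOpen hv c] with x hx
  simp [flux, hx, act_add, act_smul]

theorem Bstar_eq (w v : Euc d → ℝ) :
    P.Bstar w v = ∫ x in P.Ω, inner ℝ (P.flux w x) (wgrad P.Ω v x) :=
  integral_congr_ae (P.A_symm.mono fun _ hx => inner_act_comm hx _ _)

theorem Q_sub (hfQ : MemLp fQ 2 (volume.restrict P.Ω)) (hqQ : MemLp qQ 2 (volume.restrict P.Ω))
    (hu : MemH1 P.Ω u) (hv : MemH1 P.Ω v) :
    P.Q fQ qQ (u - v) = P.Q fQ qQ u - P.Q fQ qQ v := by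
  have hi : ∀ {z : Euc d → ℝ}, MemH1 P.Ω z → Integrable (fun x => fQ x * z x
      + inner ℝ (qQ x) (wgrad P.Ω z x)) (volume.restrict P.Ω) := fun hz =>
    (integrable_mul_of_memLp hfQ hz.1).add (integrable_inner_of_memLp hqQ hz.memLp_wgrad)
  unfold Q
  rw [← integral_sub (hi hu) (hi hv)]
  refine integral_congr_ae ?_
  filter_upwards [hu.wgrad_sub P.isOpen hv] with x hx
  simp only [hx, Pi.sub_apply, inner_sub_right]
  ring

/-! ### The guaranteed goal-oriented bound -/

/-- The correction `Cbar` is chosen so that the remaining error is the pairing of the adjoint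
residual `p - A∇z` with `A∇(u - uhat) - r/2`. By orthogonality `A∇u` lies on the sphere with
diameter from `A∇uhat` to `qhat`, so its distance to the midpoint is half of `E_CRE(uhat, qhat)`. -/
theorem abs_Q_sub_Cbar_le (hfQ : MemLp fQ 2 (volume.restrict P.Ω))
    (hqQ : MemLp qQ 2 (volume.restrict P.Ω)) (hu : P.IsSolution u) {uhat : Euc d → ℝ}
    (huhat : P.MemV uhat) {qhat : Euc d → Euc d} (hqhat : P.MemS qhat) {z : Euc d → ℝ}
    (hz : P.MemV z) {p : Euc d → Euc d} (hp : P.MemSAdjWeak fQ qQ p) :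
    |P.Q fQ qQ u - P.Q fQ qQ uhat - P.Cbar uhat qhat z p|
      ≤ (1 / 2) * (P.ECRE uhat qhat * P.ECRE z p) := by
  have hu1 := hu.1.memH1
  have huhat1 := huhat.memH1
  have hz1 := hz.memH1
  have he : P.MemV (u - uhat) := by
    simpa [sub_eq_add_neg] using hu.1.add_smul huhat (-1)
  have mAe := memLp_flux he.memH1
  have mAz := memLp_flux hz1
  have mAu := memLp_flux huhat1
  have mr : MemLp (qhat - P.flux uhat) 2 (volume.restrict P.Ω) := hqhat.1.1.sub mAu
  set Ae := P.flux (u - uhat) with hAe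
  set Az := P.flux z with hAz
  set r := qhat - P.flux uhat with hr
  have mp := hp.1
  have hfl : ∀ {v}, ∀ F : Euc d → Euc d,
      P.invInner F (P.flux v) = ∫ x in P.Ω, inner ℝ (F x) (wgrad P.Ω v x) := fun F =>
    invInner_act F _
  -- The difference `r - Ae = qhat - A∇u` is orthogonal to fluxes of `V`, as `qhat` and `A∇u` both
  -- balance the load.
  have galerkin : ∀ v, P.MemV v → P.invInner r (P.flux v) = P.invInner Ae (P.flux v) := by
    rintro v ⟨t, ht⟩
    have hv1 : MemH1 P.Ω v := ht.1.1
    have i1 := integrable_inner_of_memLp hqhat.1.1 hv1.memLp_wgrad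
    have i2 := integrable_inner_of_memLp mAu hv1.memLp_wgrad
    have i3 := integrable_inner_of_memLp (memLp_flux hu1) hv1.memLp_wgrad
    have h1 := hqhat.2 v t ht
    have h2 : ∫ x in P.Ω, inner ℝ (P.flux u x) (wgrad P.Ω v x) = P.load v t := hu.2 v t ht
    rw [hfl, hfl]
    have e1 : ∫ x in P.Ω, inner ℝ (r x) (wgrad P.Ω v x)
        = P.load v t - ∫ x in P.Ω, inner ℝ (P.flux uhat x) (wgrad P.Ω v x) := by
      rw [← h1, ← integral_sub i1 i2]
      simp [hr, inner_sub_left]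
    have e2 : ∫ x in P.Ω, inner ℝ (Ae x) (wgrad P.Ω v x)
        = P.load v t - ∫ x in P.Ω, inner ℝ (P.flux uhat x) (wgrad P.Ω v x) := by
      rw [← h2, ← integral_sub i3 i2]
      refine integral_congr_ae ?_
      filter_upwards [flux_add_smul hu1 huhat1 (-1)] with x hx
      rw [neg_one_smul, neg_one_smul, ← sub_eq_add_neg, ← sub_eq_add_neg] at hx
      rw [hAe, hx, Pi.sub_apply, inner_sub_left]
    rw [e1, e2]
  have hQ : P.Q fQ qQ u - P.Q fQ qQ uhat = P.invInner p Ae := by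
    rw [← Q_sub hfQ hqQ hu1 huhat1, hAe, hfl]
    exact (hp.2 _ he).symm
  have g1 := galerkin _ he
  have g2 := galerkin _ hz
  rw [← hAe] at g1
  rw [← hAz] at g2
  have hC : P.Cbar uhat qhat z p = 1 / 2 * P.invInner r (p + (1 : ℝ) • Az) := by
    rw [one_smul]
    rfl
  have ms : MemLp (p + (-1 : ℝ) • Az) 2 (volume.restrict P.Ω) := mp.add (mAz.const_smul _)
  have hkey : P.Q fQ qQ u - P.Q fQ qQ uhat - P.Cbar uhat qhat z p
      = P.invInner (p + (-1 : ℝ) • Az) (Ae + (-1 / 2 : ℝ) • r) := by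
    rw [hQ, hC, invInner_add_smul_right mr mp mAz, invInner_add_smul_right ms mAe mr,
      invInner_comm (p + (-1 : ℝ) • Az) Ae, invInner_comm (p + (-1 : ℝ) • Az) r,
      invInner_add_smul_right mAe mp mAz,
      invInner_add_smul_right mr mp mAz, invInner_comm Ae p, g2]
    ring
  -- Since `⟨r, Ae⟩ = ⟨Ae, Ae⟩`, the terms `⟨Ae, Ae⟩ - ⟨Ae, r⟩` cancel in the expanded square.
  have hself : P.invInner (Ae + (-1 / 2 : ℝ) • r) (Ae + (-1 / 2 : ℝ) • r)
      = (1 / 2) ^ 2 * P.invInner r r := by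
    rw [invInner_add_smul_self mAe mr, invInner_comm Ae r, g1]
    ring
  have hs : p + (-1 : ℝ) • Az = p - P.flux z := by
    rw [neg_one_smul, ← sub_eq_add_neg]
  rw [hkey]
  refine (abs_invInner_le ms (mAe.add (mr.const_smul _))).trans (le_of_eq ?_)
  rw [hself, Real.sqrt_mul (by positivity), Real.sqrt_sq (by norm_num), ECRE_eq, ECRE_eq, hs]
  ring

/-! ### The handbook function and the enrichment -/

variable {Ωhand Ω₁ Ω₂ : Set (Euc d)} {uhand σ : Euc d → ℝ}

theorem IsHandbook.memH1 (h : P.IsHandbook fQ qQ Ωhand uhand) (hΩhand_open : IsOpen Ωhand)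
    (hΩhand : Ωhand ⊆ P.Ω) : MemH1 P.Ω uhand :=
  (h.1.exists_approx hΩhand_open P.isOpen hΩhand).1

/-- Test functions on `Ω₁` are admissible in the handbook problem, which then reads `div (A∇uhand -
qQ) = -fQ` in the weak sense. -/
theorem IsHandbook.hasWeakDiv (h : P.IsHandbook fQ qQ Ωhand uhand)
    (hfQ : MemLp fQ 2 (volume.restrict P.Ω)) (hqQ : MemLp qQ 2 (volume.restrict P.Ω))
    (hΩhand_open : IsOpen Ωhand) (hΩhand : Ωhand ⊆ P.Ω) (hΩ₁ : Ω₁ ⊆ Ωhand) :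
    HasWeakDiv Ω₁ (fun x => P.flux uhand x - qQ x) (-fQ) := by
  intro φ hφ
  have hu := h.memH1 hΩhand_open hΩhand
  have hφh := hφ.mono hΩ₁
  have hm := Measure.restrict_mono (μ := volume) (hΩ₁.trans hΩhand) le_rfl
  have key := h.2 φ hφh.memH10
  have ae_hand : ∀ {p : Euc d → Prop}, (∀ᵐ x ∂(volume.restrict P.Ω), p x) →
      ∀ᵐ x ∂(volume.restrict Ωhand), p x := fun hp => ae_restrict_of_ae_restrict_of_subset hΩhand hp
  have e1 : ∫ x in Ωhand, inner ℝ (act (P.A x) (wgrad Ωhand φ x)) (wgrad Ωhand uhand x)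
      = ∫ x in Ω₁, fderiv ℝ φ x (P.flux uhand x) := by
    rw [← setIntegral_eq_of_vanish hΩhand_open.measurableSet hΩ₁ fun x hx => by
      simp [hφ.fderiv_eq_zero hx]]
    refine integral_congr_ae ?_
    filter_upwards [ae_hand P.A_symm, hφ.wgrad_ae_eq hΩhand_open,
      hu.wgrad_mono P.isOpen hΩhand_open hΩhand] with x h1 h2 h3
    rw [h2, h3, inner_act_comm h1, ← inner_gradient, real_inner_comm]
    rfl
  have e2 : ∫ x in Ωhand, (fQ x * φ x + inner ℝ (qQ x) (wgrad Ωhand φ x))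
      = ∫ x in Ω₁, (fQ x * φ x + fderiv ℝ φ x (qQ x)) := by
    rw [← setIntegral_eq_of_vanish hΩhand_open.measurableSet hΩ₁ fun x hx => by
      simp [hφ.fderiv_eq_zero hx, hφ.eq_zero hx]]
    refine integral_congr_ae ?_
    filter_upwards [hφ.wgrad_ae_eq hΩhand_open] with x h2
    rw [h2, ← inner_gradient, real_inner_comm]
  have hi : ∀ {p : Euc d → Euc d}, MemLp p 2 (volume.restrict P.Ω) →
      Integrable (fun x => fderiv ℝ φ x (p x)) (volume.restrict Ω₁) := fun hp => by
    simpa only [inner_gradient] using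
      integrable_inner_of_memLp (hφ.memLp_gradient Ω₁ 2) (hp.mono_measure hm)
  have hif := integrable_mul_of_memLp (hfQ.mono_measure hm) (hφ.memLp Ω₁ 2)
  rw [e1, e2, integral_add hif (hi hqQ)] at key
  simp only [map_sub, Pi.neg_apply, neg_mul]
  rw [integral_sub (hi (memLp_flux hu)) (hi hqQ), integral_neg, key]
  ring

theorem IsHandbook.memHdiv (h : P.IsHandbook fQ qQ Ωhand uhand)
    (hfQ : MemLp fQ 2 (volume.restrict P.Ω)) (hqQ : MemLp qQ 2 (volume.restrict P.Ω))
    (hΩhand_open : IsOpen Ωhand) (hΩhand : Ωhand ⊆ P.Ω) (hΩ₁ : Ω₁ ⊆ Ωhand) :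
    MemHdiv Ω₁ (fun x => P.flux uhand x - qQ x) :=
  ⟨((memLp_flux (h.memH1 hΩhand_open hΩhand)).sub hqQ).mono_measure
      (Measure.restrict_mono (hΩ₁.trans hΩhand) le_rfl), -fQ,
    (hfQ.mono_measure (Measure.restrict_mono (hΩ₁.trans hΩhand) le_rfl)).neg,
    h.hasWeakDiv hfQ hqQ hΩhand_open hΩhand hΩ₁⟩

/-- In Green's formula the divergence contributes `-∫ fQ v`, which joins `-∫ qQ·∇v` to form `-Q(v)`:
the data of `Q` vanish outside `Ω₁`, so integrating over `Ω₁` loses nothing. -/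
theorem IsHandbook.normalPairing_eq (h : P.IsHandbook fQ qQ Ωhand uhand)
    (hfQ : MemLp fQ 2 (volume.restrict P.Ω)) (hqQ : MemLp qQ 2 (volume.restrict P.Ω))
    (hΩhand_open : IsOpen Ωhand) (hΩhand : Ωhand ⊆ P.Ω) (hΩ₁_open : IsOpen Ω₁)
    (hΩ₁ : Ω₁ ⊆ Ωhand)
    (hsupp : ∀ᵐ x ∂(volume.restrict (P.Ω \ Ω₁)), fQ x = 0 ∧ qQ x = 0) (hv : MemH1 P.Ω v) :
    normalPairing Ω₁ (fun x => P.flux uhand x - qQ x) v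
      = (∫ x in Ω₁, inner ℝ (P.flux uhand x) (wgrad P.Ω v x)) - P.Q fQ qQ v := by
  have hΩ₁Ω := hΩ₁.trans hΩhand
  have hm := Measure.restrict_mono (μ := volume) hΩ₁Ω le_rfl
  have mfl := (memLp_flux (h.memH1 hΩhand_open hΩhand)).mono_measure hm
  have mq := hqQ.mono_measure hm
  have mf := hfQ.mono_measure hm
  have mv := hv.1.mono_measure hm
  have mg := hv.memLp_wgrad.mono_measure hm
  have e1 : ∫ x in Ω₁, inner ℝ (P.flux uhand x - qQ x) (wgrad Ω₁ v x)
      = (∫ x in Ω₁, inner ℝ (P.flux uhand x) (wgrad P.Ω v x))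
        - ∫ x in Ω₁, inner ℝ (qQ x) (wgrad P.Ω v x) := by
    rw [← integral_sub (integrable_inner_of_memLp mfl mg) (integrable_inner_of_memLp mq mg)]
    refine integral_congr_ae ?_
    filter_upwards [hv.wgrad_mono P.isOpen hΩ₁_open hΩ₁Ω] with x hx
    rw [hx, inner_sub_left]
  have e2 : ∫ x in Ω₁, wdiv Ω₁ (fun x => P.flux uhand x - qQ x) x * v x
      = - ∫ x in Ω₁, fQ x * v x := by
    rw [← integral_neg]
    refine integral_congr_ae ?_
    filter_upwards [wdiv_ae_eq hΩ₁_open (mfl.sub mq) mf.neg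
      (h.hasWeakDiv hfQ hqQ hΩhand_open hΩhand hΩ₁)] with x hx
    have hx' : wdiv Ω₁ (fun x => P.flux uhand x - qQ x) x = -fQ x := hx
    rw [hx', neg_mul]
  have e3 : P.Q fQ qQ v
      = (∫ x in Ω₁, fQ x * v x) + ∫ x in Ω₁, inner ℝ (qQ x) (wgrad P.Ω v x) := by
    rw [← integral_add (integrable_mul_of_memLp mf mv) (integrable_inner_of_memLp mq mg)]
    refine (setIntegral_eq_of_subset_of_ae_sdiff_eq_zero P.isOpen.measurableSet.nullMeasurableSet
      hΩ₁Ω ?_)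
    filter_upwards [(ae_restrict_iff'
      (P.isOpen.measurableSet.diff hΩ₁_open.measurableSet)).1 hsupp] with x hx hxm
    simp [hx hxm]
  rw [normalPairing, e1, e2, e3]
  ring

theorem Bstar_enrichment (h : MemH10 Ωhand uhand) (hΩhand_open : IsOpen Ωhand)
    (hΩhand : Ωhand ⊆ P.Ω) (hΩ₁_open : IsOpen Ω₁) (hΩ₁ : Ω₁ ⊆ P.Ω) (hσ : IsCutoff P.Ω σ)
    (hΩ₁σ : Ω₁ =ᵐ[volume] {x ∈ P.Ω | σ x = 1}) (hΩ₂ : Ω₂ = {x ∈ P.Ω | σ x ∈ Ioo (0 : ℝ) 1})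
    (hv : MemH1 P.Ω v) :
    P.Bstar (uhand * σ) v = (∫ x in Ω₁, inner ℝ (P.flux uhand x) (wgrad P.Ω v x))
      + ∫ x in Ω₂, inner ℝ (P.flux (uhand * σ) x) (wgrad P.Ω v x) := by
  have hΩ₂_open : IsOpen Ω₂ := by
    rw [hΩ₂]
    exact (hσ.continuousOn.mono subset_closure).isOpen_inter_preimage P.isOpen isOpen_Ioo
  have hΩ₂Ω : Ω₂ ⊆ P.Ω := by
    rw [hΩ₂]
    exact fun x hx => hx.1
  have hu := (h.exists_approx hΩhand_open P.isOpen hΩhand).1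
  have i1 := integrable_inner_of_memLp (memLp_flux hu) hv.memLp_wgrad
  have i2 := integrable_inner_of_memLp
    (memLp_flux (h.memH1_mul hΩhand_open P.isOpen hΩhand hσ)) hv.memLp_wgrad
  have r1 : ∀ (s : Set (Euc d)) (f : Euc d → ℝ), IsOpen s → s ⊆ P.Ω →
      ∫ x in s, f x = ∫ x in P.Ω, s.indicator f x := fun s f hs hsΩ => by
    rw [setIntegral_indicator hs.measurableSet, inter_eq_self_of_subset_right hsΩ]
  rw [Bstar_eq, r1 Ω₁ _ hΩ₁_open hΩ₁, r1 Ω₂ _ hΩ₂_open hΩ₂Ω,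
    ← integral_add (i1.indicator hΩ₁_open.measurableSet) (i2.indicator hΩ₂_open.measurableSet)]
  refine integral_congr_ae ?_
  filter_upwards [h.wgrad_mul_ae_eq hΩhand_open P.isOpen hΩhand hσ,
    ae_restrict_of_ae hΩ₁σ.mem_iff, ae_restrict_mem P.isOpen.measurableSet] with x h1 h2 hx
  have hfw : P.flux (uhand * σ) x =
      act (P.A x) (σ x • wgrad P.Ω uhand x + uhand x • gradient σ x) := by
    rw [flux, h1]
    rfl
  have hm1 : x ∈ Ω₁ ↔ σ x = 1 := h2.trans ⟨fun h => h.2, fun h => ⟨hx, h⟩⟩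
  have hm2 : x ∈ Ω₂ ↔ σ x ∈ Ioo (0 : ℝ) 1 := by
    rw [hΩ₂]
    exact ⟨fun h => h.2, fun h => ⟨hx, h⟩⟩
  obtain ⟨h0, h1⟩ := hσ.mem_Icc x hx
  -- Pointwise comparison in the zones `σ = 0`, `σ = 1` and `0 < σ < 1`. In the first two `∇σ = 0`,
  -- so the flux of `uhand * σ` is `σ A∇uhand`.
  rcases h0.eq_or_lt with h0 | h0
  · have n1 : x ∉ Ω₁ := fun hc => by linarith [hm1.1 hc]
    have n2 : x ∉ Ω₂ := fun hc => by linarith [(hm2.1 hc).1]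
    rw [indicator_of_notMem n1, indicator_of_notMem n2, hfw,
      hσ.gradient_eq_zero_of_eq_zero P.isOpen hx h0.symm, ← h0]
    simp [act]
  rcases h1.eq_or_lt with h1 | h1
  · have n2 : x ∉ Ω₂ := fun hc => by linarith [(hm2.1 hc).2]
    rw [indicator_of_mem (hm1.2 h1), indicator_of_notMem n2, hfw,
      hσ.gradient_eq_zero_of_eq_one P.isOpen hx h1, h1]
    simp [flux]
  · have n1 : x ∉ Ω₁ := fun hc => by linarith [hm1.1 hc]
    rw [indicator_of_notMem n1, indicator_of_mem (hm2.2 ⟨h0, h1⟩), zero_add]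

/-- If `q_Q` belongs to `H(div, Ω)`, then so do the equilibrated fluxes of the adjoint problem. -/
theorem MemSAdjWeak.memSAdj {p : Euc d → Euc d} (h : P.MemSAdjWeak fQ qQ p)
    (hfQ : MemLp fQ 2 (volume.restrict P.Ω)) (hq : MemHdiv P.Ω qQ) : P.MemSAdj fQ qQ p := by
  obtain ⟨mq, D, mD, hD⟩ := hq
  -- Restricted to test functions, the equilibrium reads `-div p = fQ - div qQ`, whence the
  -- divergence `D - fQ`.
  refine ⟨⟨h.1, D - fQ, mD.sub hfQ, fun φ hφ => ?_⟩, h.2⟩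
  have key := h.2 φ ⟨0, memVWith_of_isTest hφ⟩
  have hφw := hφ.wgrad_ae_eq P.isOpen
  have e1 : ∫ x in P.Ω, inner ℝ (p x) (wgrad P.Ω φ x) = ∫ x in P.Ω, fderiv ℝ φ x (p x) := by
    refine integral_congr_ae (hφw.mono fun x hx => ?_)
    simp only [hx]
    rw [← inner_gradient, real_inner_comm]
  have iq : Integrable (fun x => fderiv ℝ φ x (qQ x)) (volume.restrict P.Ω) := by
    simpa only [inner_gradient] using integrable_inner_of_memLp (hφ.memLp_gradient P.Ω 2) mq
  have e2 : P.Q fQ qQ φ = (∫ x in P.Ω, fQ x * φ x) + ∫ x in P.Ω, fderiv ℝ φ x (qQ x) := by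
    rw [← integral_add (integrable_mul_of_memLp hfQ (hφ.memLp P.Ω 2)) iq]
    refine integral_congr_ae (hφw.mono fun x hx => ?_)
    simp only [hx]
    rw [← inner_gradient, real_inner_comm]
  rw [← e1, key, e2, hD φ hφ]
  simp only [Pi.sub_apply, sub_mul]
  rw [integral_sub (integrable_mul_of_memLp mD (hφ.memLp P.Ω 2))
    (integrable_mul_of_memLp hfQ (hφ.memLp P.Ω 2))]
  ring

theorem ECRE_congr {z : Euc d → ℝ} {p q : Euc d → Euc d}
    (h : p - P.flux u =ᵐ[volume.restrict P.Ω] q - P.flux z) : P.ECRE u p = P.ECRE z q := by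
  unfold ECRE
  congr 1
  refine integral_congr_ae (h.mono fun x hx => ?_)
  simp only [Pi.sub_apply] at hx
  simp only [hx]

end ModelProblem

/-- `X` lies in an interval whose endpoints are the two values of `θ`, and on an interval the
absolute value is largest at an endpoint. -/
theorem abs_le_etaQ {X D C E₁ E₂ : ℝ} (h : |X - D - C| ≤ (1 / 2) * (E₁ * E₂)) :
    |X| ≤ etaQ D C E₁ E₂ := by
  obtain ⟨h1, h2⟩ := abs_le.1 h
  refine abs_le.2 ⟨?_, ?_⟩
  · have := (neg_abs_le (D + C + (-1 / 2) * (E₁ * E₂))).trans (by linarith : _ ≤ X)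
    have h3 : |D + C + (-1 / 2) * (E₁ * E₂)| ≤ etaQ D C E₁ E₂ := le_max_right _ _
    linarith
  · have := (by linarith : X ≤ D + C + (1 / 2) * (E₁ * E₂)).trans (le_abs_self _)
    exact this.trans (le_max_left _ _)

end MsFEM

/-! ### Assembly of the theorem. -/

open MsFEM in
theorem mainTheorem2 {d : ℕ} (P : ModelProblem d) (T : Mesh P.Ω)
    -- first-order Lagrange basis functions of the coarse mesh
    (φ : Euc d → Euc d → ℝ) (hφ : T.IsLagrangeBasis φ)
    -- MsFEM trial and test spaces, possibly nonconforming
    (VH WH : Submodule ℝ (Euc d → ℝ)) [FiniteDimensional ℝ VH] [FiniteDimensional ℝ WH]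
    (hVH : ∀ v ∈ VH, T.MemBrokenH1 v) (hWH : ∀ v ∈ WH, T.MemBrokenH1 v)
    -- quantity of interest
    (fQ : Euc d → ℝ) (qQ : Euc d → Euc d)
    (hfQ : MemLp fQ 2 (volume.restrict P.Ω)) (hqQ : MemLp qQ 2 (volume.restrict P.Ω))
    -- the enriched region, a union of coarse elements that contains the support of `fQ` and `qQ`
    (Ωhand : Set (Euc d)) (hΩhand_open : IsOpen Ωhand) (hΩhand : Ωhand ⊆ P.Ω)
    (J : Finset (Fin T.N)) (Ω₁ Ω₂ : Set (Euc d))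
    (hΩ₁ : Ω₁ = T.subdomain J) (hΩ₁hand : Ω₁ ⊆ Ωhand)
    (hsupp : ∀ᵐ x ∂(volume.restrict (P.Ω \ Ω₁)), fQ x = 0 ∧ qQ x = 0)
    (hΩ₁pum : Ω₁ =ᵐ[volume] {x ∈ P.Ω | T.pum φ Ω₁ x = 1})
    (hΩ₂ : Ω₂ = {x ∈ P.Ω | T.pum φ Ω₁ x ∈ Ioo (0 : ℝ) 1})
    -- handbook function and enrichment part
    (uhand : Euc d → ℝ) (huhand : P.IsHandbook fQ qQ Ωhand uhand)
    (w : Euc d → ℝ) (hw : w = fun x => uhand x * T.pum φ Ω₁ x)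
    -- exact solution, MsFEM solution, recovered field and equilibrated flux
    (u : Euc d → ℝ) (hu : P.IsSolution u)
    (uH : Euc d → ℝ) (huH : P.IsMsFEMSolution T VH WH uH)
    (uhat : Euc d → ℝ) (huhat : P.MemV uhat)
    (qhat : Euc d → Euc d) (hqhat : P.MemS qhat)
    -- residual adjoint solution, recovered field and equilibrated flux
    (ures : Euc d → ℝ) (hures : P.IsMsFEMResidual T fQ qQ VH WH w ures)
    (ureshat : Euc d → ℝ) (hureshat : P.MemV ureshat)
    (qreshat : Euc d → Euc d) (hqreshat : P.MemSRes qQ Ω₁ Ω₂ uhand w qreshat)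
    -- enriched adjoint field and flux, correction terms
    (uplus : Euc d → ℝ) (huplus : uplus = fun x => w x + ureshat x)
    (qplus : Euc d → Euc d) (hqplus : qplus = fun x => P.flux w x + qreshat x)
    (ΔQ C : ℝ) (hΔQ : ΔQ = P.QH T fQ qQ (uhat - uH))
    (hC : C = P.Cbar uhat qhat uplus qplus) :
    -- the piecewise form of the quantity of interest extends `Q`
    (∀ v, MemH1 P.Ω v → P.QH T fQ qQ v = P.Q fQ qQ v) ∧
    -- the enrichment part and the enriched adjoint field are admissible
    P.MemV w ∧ P.MemV uplus ∧
    -- the three forms of the residual adjoint loading coincide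
    MemHdiv Ω₁ (fun x => P.flux uhand x - qQ x) ∧
    (∀ v, P.MemV v →
      P.Q fQ qQ v - P.Bstar w v
        = P.Q fQ qQ v - (∫ x in Ω₁, inner ℝ (P.flux uhand x) (wgrad P.Ω v x))
            - ∫ x in Ω₂, inner ℝ (P.flux w x) (wgrad P.Ω v x) ∧
      P.Q fQ qQ v - P.Bstar w v = P.resLoad qQ Ω₁ Ω₂ uhand w v) ∧
    -- the enriched flux is equilibrated
    P.MemSAdjWeak fQ qQ qplus ∧
    (MemHdiv P.Ω qQ → P.MemSAdj fQ qQ qplus) ∧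
    -- the goal-oriented bounds
    |P.Q fQ qQ u - P.QH T fQ qQ uH - ΔQ - C|
      ≤ (1 / 2) * (P.ECRE uhat qhat * P.ECRE uplus qplus) ∧
    P.ECRE uplus qplus = P.ECRE ureshat qreshat ∧
    |P.Q fQ qQ u - P.QH T fQ qQ uH|
      ≤ etaQ ΔQ C (P.ECRE uhat qhat) (P.ECRE ureshat qreshat) := by
  have hσ : IsCutoff P.Ω (T.pum φ Ω₁) := T.isCutoff_pum hφ Ω₁
  have hΩ₁_open : IsOpen Ω₁ := hΩ₁ ▸ isOpen_interior
  have hw' : w = uhand * T.pum φ Ω₁ := hw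
  have hwV : P.MemV w := ⟨0, by
    rw [hw']
    exact ⟨huhand.1.hasTrace_mul hΩhand_open P.isOpen hΩhand hσ, Eventually.of_forall fun _ => rfl⟩⟩
  have huplus' : uplus = w + (1 : ℝ) • ureshat := by rw [one_smul, huplus]; rfl
  have huplusV : P.MemV uplus := huplus' ▸ hwV.add_smul hureshat 1
  have hforms : ∀ v, P.MemV v →
      P.Q fQ qQ v - P.Bstar w v
        = P.Q fQ qQ v - (∫ x in Ω₁, inner ℝ (P.flux uhand x) (wgrad P.Ω v x))
            - ∫ x in Ω₂, inner ℝ (P.flux w x) (wgrad P.Ω v x) ∧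
      P.Q fQ qQ v - P.Bstar w v = P.resLoad qQ Ω₁ Ω₂ uhand w v := by
    intro v hv
    have h1 := ModelProblem.Bstar_enrichment huhand.1 hΩhand_open hΩhand hΩ₁_open
      (hΩ₁hand.trans hΩhand) hσ hΩ₁pum hΩ₂ hv.memH1
    have h2 := huhand.normalPairing_eq hfQ hqQ hΩhand_open hΩhand hΩ₁_open hΩ₁hand hsupp hv.memH1
    rw [← hw'] at h1
    constructor
    · rw [h1]
      ring
    · rw [ModelProblem.resLoad, h1, h2]
      ring
  have hqplusW : P.MemSAdjWeak fQ qQ qplus := by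
    have mfl := ModelProblem.memLp_flux hwV.memH1
    refine ⟨hqplus ▸ mfl.add hqreshat.1, fun v hv => ?_⟩
    have mg := hv.memH1.memLp_wgrad
    have h1 := (hforms v hv).2
    rw [← hqreshat.2 v hv, ModelProblem.Bstar_eq] at h1
    simp only [hqplus, inner_add_left]
    rw [integral_add (integrable_inner_of_memLp mfl mg)
      (integrable_inner_of_memLp hqreshat.1 mg), ← h1]
    ring
  -- The flux `A∇w` occurs in both `qplus` and `A∇uplus`, so it drops out of their difference.
  have hE : P.ECRE uplus qplus = P.ECRE ureshat qreshat := by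
    refine ModelProblem.ECRE_congr ?_
    filter_upwards [ModelProblem.flux_add_smul hwV.memH1 hureshat.memH1 1] with x hx
    rw [huplus', hqplus]
    rw [Pi.sub_apply, hx, Pi.sub_apply, Pi.add_apply, Pi.smul_apply, one_smul]
    abel
  -- With this splitting the broken value at `uH` cancels from the error, leaving the conforming
  -- quantity `Q(u) - Q(uhat) - C`.
  have hΔ : ΔQ = P.Q fQ qQ uhat - P.QH T fQ qQ uH := by
    rw [hΔQ, ModelProblem.QH_sub T hfQ hqQ (huhat.memBrokenH1 T) (hVH uH huH.1),
      ModelProblem.QH_eq_Q T hfQ hqQ huhat.memH1]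
  have hbound : |P.Q fQ qQ u - P.QH T fQ qQ uH - ΔQ - C|
      ≤ (1 / 2) * (P.ECRE uhat qhat * P.ECRE uplus qplus) := by
    have h1 := ModelProblem.abs_Q_sub_Cbar_le hfQ hqQ hu huhat hqhat huplusV hqplusW
    rw [hΔ, hC]
    convert h1 using 2
    ring
  refine ⟨fun v hv => ModelProblem.QH_eq_Q T hfQ hqQ hv, hwV, huplusV,
    huhand.memHdiv hfQ hqQ hΩhand_open hΩhand hΩ₁hand, hforms, hqplusW,
    fun hq => hqplusW.memSAdj hfQ hq, hbound, hE, ?_⟩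
  rw [hE] at hbound
  exact abs_le_etaQ hbound
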